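/- Let $E\to M$ be a Courant algebroid over a smooth manifold $M$, that is, a smooth real vector bundle of finite rank with a smooth nondegenerate symmetric bilinear form $\langle\cdot,\cdot\rangle$ on its fibres, a bundle map $\rho:E\to TM$ and an $\mathbb R$-bilinear bracket $[\cdot,\cdot]$ on $\Gamma^\infty(E)$ such that, for all sections $e_1,e_2,e_3$, $$[e_1,[e_2,e_3]]=[[e_1,e_2],e_3]+[e_2,[e_1,e_3]],\qquad [e_1,e_2]+[e_2,e_1]=\mathcal D\langle e_1,e_2\rangle ,$$ $$\rho(e_1)\langle e_2,e_3\rangle=\langle[e_1,e_2],e_3\rangle+\langle e_2,[e_1,e_3]\rangle ,$$ where $\langle\mathcal Df,e\rangle=\rho(e)f$. Let $L\subseteq E$ be a Dirac structure, i.e. a maximally isotropic smooth subbundle with $[\Gamma^\infty(L),\Gamma^\infty(L)]\subseteq\Gamma^\infty(L)$, and let $L'$ be an isotropic smooth subbundle with $E=L\oplus L'$. Identify $L'$ with $L^*$ through $\langle\cdot,\cdot\rangle$, so that $E\cong L\oplus L^*$. Let $d_L$ be the Lie algebroid differential of $L$ (anchor $\rho|_L$ and the restricted bracket) on $\Gamma^\infty(\bigwedge^\bullet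 L^*)$, $$d_L\eta(s_0,\dots,s_k)=\sum_i(-1)^i\rho(s_i)\,\eta(\dots,\widehat{s_i},\dots)+\sum_{i<j}(-1)^{i+j}\eta([s_i,s_j],\dots,\widehat{s_i},\dots,\widehat{s_j},\dots).$$ For $\alpha,\beta\in\Gamma^\infty(L^*)$ put $[\alpha,\beta]_*=\mathrm{pr}_{L^*}[\alpha,\beta]$, and extend this bracket to $\Gamma^\infty(\bigwedge^\bullet L^*)$ by $[f,g]_*=0$, $[\alpha,f]_*=\rho(\alpha)f=-[f,\alpha]_*$ and the graded Leibniz rule, so that $$[\alpha_1\wedge\alpha_2,\beta_1\wedge\beta_2]_*=\sum_{i,j=1}^2(-1)^{i+j}[\alpha_i,\beta_j]_*\wedge\alpha_{3-i}\wedge\beta_{3-j}.$$ Let $\psi(\alpha,\beta,\gamma)=-\langle[\alpha,\beta],\gamma\rangle$ for $\alpha,\beta,\gamma\in\Gamma^\infty(L^*)$ and, for two-forms $\omega,\mu,\nu\in\Gamma^\infty(\bigwedge^2L^*)$, regarded as maps $L\to L^*$ by $\omega(s)(t)=\omega(s,t)$, let $$[\omega,\mu,\nu]_\psi(s_1,s_2,s_3)=-\sum_{\pi\in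 S_3}\operatorname{sgn}(\pi)\,\psi\bigl(\omega(s_{\pi(1)}),\mu(s_{\pi(2)}),\nu(s_{\pi(3)})\bigr),$$ so that $\tfrac16[\omega,\omega,\omega]_\psi(s_1,s_2,s_3)=\langle[\omega(s_1),\omega(s_2)],\omega(s_3)\rangle$. Let $N\ge 0$. A formal deformation of $L$ of order $N$ is a formal series $\omega_t=t\omega_1+t^2\omega_2+\cdots$ with $\omega_i\in\Gamma^\infty(\bigwedge^2L^*)$ for which the equation $$d_L\omega_t+\tfrac12[\omega_t,\omega_t]_*+\tfrac16[\omega_t,\omega_t,\omega_t]_\psi=0$$ holds up to order $N$ in $t$ (only $\omega_1,\dots,\omega_N$ matter). Let such an $\omega_t$ be given. Then $$R_{N+1}=-\frac12\sum_{i=1}^{N}[\omega_i,\omega_{N+1-i}]_*-\frac16\sum_{\substack{i,j,k\ge1\\ i+j+k=N+1}}[\omega_i,\omega_j,\omega_k]_\psi\in\Gamma^\infty(\textstyle\bigwedge^3L^*)$$ satisfies $d_LR_{N+1}=0$. Moreover the deformation extends to order $N+1$, i.e. there is a formal deformation of order $N+1$ with the same coefficients $\omega_1,\dots,\omega_N$,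 if and only if $R_{N+1}=d_L\eta$ for some $\eta\in\Gamma^\infty(\bigwedge^2L^*)$; equivalently, if and only if the class of $R_{N+1}$ in the third Lie algebroid cohomology $H^3(L)=\ker\bigl(d_L|_{\Gamma^\infty(\bigwedge^3L^*)}\bigr)/d_L\,\Gamma^\infty(\bigwedge^2L^*)$ vanishes. -/

import Mathlib

open scoped Manifold ContDiff Bundle

namespace CourantDeformation

noncomputable section

section Basics

variable {n : ℕ} {M : Type*} [TopologicalSpace M] [ChartedSpace (EuclideanSpace ℝ (Fin n)) M]
variable (F : Type*) [NormedAddCommGroup F] [NormedSpace ℝ F]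
variable (E : M → Type*) [∀ x, AddCommGroup (E x)] [∀ x, Module ℝ (E x)]
  [∀ x, TopologicalSpace (E x)] [TopologicalSpace (Bundle.TotalSpace F E)]
  [FiberBundle F E] [VectorBundle ℝ F E]

/-- The algebra `C^∞(M)` of smooth real functions on the manifold `M`. -/
abbrev SmoothFun (n : ℕ) (M : Type*) [TopologicalSpace M]
    [ChartedSpace (EuclideanSpace ℝ (Fin n)) M] : Type _ :=
  C^∞⟮𝓡 n, M; 𝓘(ℝ), ℝ⟯

/-- The space `Γ^∞(E)` of smooth sections of the vector bundle `E → M`. -/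
abbrev Sections (n : ℕ) {M : Type*} [TopologicalSpace M]
    [ChartedSpace (EuclideanSpace ℝ (Fin n)) M]
    (F : Type*) [NormedAddCommGroup F] [NormedSpace ℝ F]
    (E : M → Type*) [∀ x, TopologicalSpace (E x)]
    [TopologicalSpace (Bundle.TotalSpace F E)] [FiberBundle F E] : Type _ :=
  Cₛ^∞⟮𝓡 n; F, E⟯

/-- Pointwise multiplication of a section by a smooth function. -/
instance instSMulSections : SMul (SmoothFun n M) (Sections n F E) where
  smul f s := ⟨fun x => f x • s x, f.contMDiff.smul_section s.contMDiff⟩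

variable {F E} in
@[simp] theorem smul_section_apply (f : SmoothFun n M) (s : Sections n F E) (x : M) :
    (f • s) x = f x • s x := rfl

/-- `Γ^∞(E)` is a module over `C^∞(M)`. -/
instance instModuleSections : Module (SmoothFun n M) (Sections n F E) where
  one_smul s := by ext x; exact one_smul ℝ (s x)
  mul_smul f g s := by ext x; exact mul_smul (f x) (g x) (s x)
  smul_zero f := by ext x; exact smul_zero (f x)
  smul_add f s t := by ext x; exact smul_add (f x) (s x) (t x)
  add_smul f g s := by ext x; exact add_smul (f x) (g x) (s x)
  zero_smul s := by ext x; exact zero_smul ℝ (s x)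

instance instIsScalarTowerSections : IsScalarTower ℝ (SmoothFun n M) (Sections n F E) where
  smul_assoc r f s := by ext x; exact smul_assoc r (f x) (s x)

variable {F E} in
theorem sum_section_apply {ι : Type*} (t : Finset ι) (s : ι → Sections n F E) (x : M) :
    (∑ i ∈ t, s i) x = ∑ i ∈ t, s i x := by
  classical
  induction t using Finset.induction_on with
  | empty => simp
  | insert a t ha ih => simp [Finset.sum_insert ha, ih]

/-- A smooth vector bundle `E → M` with a smooth nondegenerate symmetric bilinear form on its
fibres and an anchor, that is, a smooth vector bundle homomorphism `ρ : E → TM`.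
A fibrewise linear map is a smooth bundle map if and only if it maps smooth sections to smooth
sections, and likewise for bilinear forms. -/
structure AnchoredMetric (n : ℕ) {M : Type*} [TopologicalSpace M]
    [ChartedSpace (EuclideanSpace ℝ (Fin n)) M] [IsManifold (𝓡 n) ∞ M]
    (F : Type*) [NormedAddCommGroup F] [NormedSpace ℝ F]
    (E : M → Type*) [∀ x, AddCommGroup (E x)] [∀ x, Module ℝ (E x)]
    [∀ x, TopologicalSpace (E x)] [TopologicalSpace (Bundle.TotalSpace F E)]
    [FiberBundle F E] [VectorBundle ℝ F E] where
  /-- the bilinear form `⟨·,·⟩` on the fibre over `x` -/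
  form : ∀ x, LinearMap.BilinForm ℝ (E x)
  form_symm : ∀ x u v, form x u v = form x v u
  form_nondegenerate : ∀ x u, (∀ v, form x u v = 0) → u = 0
  form_smooth : ∀ e₁ e₂ : Sections n F E,
    ContMDiff (𝓡 n) 𝓘(ℝ) ∞ (fun x => form x (e₁ x) (e₂ x))
  /-- the anchor `ρ` on the fibre over `x` -/
  anchor : ∀ x, E x →ₗ[ℝ] TangentSpace (𝓡 n) x
  anchor_smooth : ∀ e : Sections n F E,
    ContMDiff (𝓡 n) (𝓡 n).tangent ∞
      (fun x => (⟨x, anchor x (e x)⟩ : TangentBundle (𝓡 n) M))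

end Basics

section AnchoredMetricLemmas

variable {n : ℕ} {M : Type*} [TopologicalSpace M] [ChartedSpace (EuclideanSpace ℝ (Fin n)) M]
  [IsManifold (𝓡 n) ∞ M]
  {F : Type*} [NormedAddCommGroup F] [NormedSpace ℝ F]
  {E : M → Type*} [∀ x, AddCommGroup (E x)] [∀ x, Module ℝ (E x)]
  [∀ x, TopologicalSpace (E x)] [TopologicalSpace (Bundle.TotalSpace F E)]
  [FiberBundle F E] [VectorBundle ℝ F E]

namespace AnchoredMetric

variable (B : AnchoredMetric n F E)

/-- The function `⟨e₁, e₂⟩ ∈ C^∞(M)` for sections `e₁, e₂`. -/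
def pair (e₁ e₂ : Sections n F E) : SmoothFun n M :=
  ⟨fun x => B.form x (e₁ x) (e₂ x), B.form_smooth e₁ e₂⟩

/-- The derivative `ρ(e) f ∈ C^∞(M)` of the function `f` along the vector field `ρ(e)`. -/
def act (e : Sections n F E) (f : SmoothFun n M) : SmoothFun n M :=
  ⟨fun x => mvfderiv (𝓡 n) (f : M → ℝ) x (B.anchor x (e x)), by
    have h1 : ContMDiff (𝓡 n).tangent 𝓘(ℝ).tangent ∞ (tangentMap (𝓡 n) 𝓘(ℝ) (f : M → ℝ)) :=
      f.contMDiff.contMDiff_tangentMap (by simp)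
    have h2 := h1.comp (B.anchor_smooth e)
    exact (contMDiff_snd_tangentBundle_modelSpace ℝ 𝓘(ℝ)).comp h2⟩

@[simp] theorem pair_apply (e₁ e₂ : Sections n F E) (x : M) :
    B.pair e₁ e₂ x = B.form x (e₁ x) (e₂ x) := rfl

@[simp] theorem act_apply (e : Sections n F E) (f : SmoothFun n M) (x : M) :
    B.act e f x = mvfderiv (𝓡 n) (f : M → ℝ) x (B.anchor x (e x)) := rfl

theorem pair_comm (e₁ e₂ : Sections n F E) : B.pair e₁ e₂ = B.pair e₂ e₁ := by
  ext x; exact B.form_symm x _ _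

theorem pair_add_left (e e' e₂ : Sections n F E) :
    B.pair (e + e') e₂ = B.pair e e₂ + B.pair e' e₂ := by
  ext x; simp

theorem pair_smul_left (f : SmoothFun n M) (e e₂ : Sections n F E) :
    B.pair (f • e) e₂ = f * B.pair e e₂ := by
  ext x; simp

theorem pair_add_right (e e₁ e₂ : Sections n F E) :
    B.pair e (e₁ + e₂) = B.pair e e₁ + B.pair e e₂ := by
  ext x; simp

theorem pair_smul_right (f : SmoothFun n M) (e e₂ : Sections n F E) :
    B.pair e (f • e₂) = f * B.pair e e₂ := by
  ext x; simp

theorem pair_neg_left (e e₂ : Sections n F E) : B.pair (-e) e₂ = -B.pair e e₂ := by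
  ext x; simp

/-- The pairing as a `C^∞(M)`-bilinear map. -/
def pairLM : Sections n F E →ₗ[SmoothFun n M] Sections n F E →ₗ[SmoothFun n M] SmoothFun n M :=
  LinearMap.mk₂ _ B.pair B.pair_add_left B.pair_smul_left B.pair_add_right B.pair_smul_right

@[simp] theorem pairLM_apply (e₁ e₂ : Sections n F E) : B.pairLM e₁ e₂ = B.pair e₁ e₂ := rfl

theorem act_add_left (e e' : Sections n F E) (f : SmoothFun n M) :
    B.act (e + e') f = B.act e f + B.act e' f := by
  ext x; simp

theorem act_smul_left (g : SmoothFun n M) (e : Sections n F E) (f : SmoothFun n M) :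
    B.act (g • e) f = g * B.act e f := by
  ext x; simp

theorem act_add_right (e : Sections n F E) (f g : SmoothFun n M) :
    B.act e (f + g) = B.act e f + B.act e g := by
  ext x
  have hf : MDifferentiableAt (𝓡 n) 𝓘(ℝ) (f : M → ℝ) x :=
    f.contMDiff.mdifferentiable (by simp) x
  have hg : MDifferentiableAt (𝓡 n) 𝓘(ℝ) (g : M → ℝ) x :=
    g.contMDiff.mdifferentiable (by simp) x
  simp [mvfderiv_add hf hg]

theorem act_mul_right (e : Sections n F E) (f g : SmoothFun n M) :
    B.act e (f * g) = f * B.act e g + g * B.act e f := by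
  ext x
  have hf : MDifferentiableAt (𝓡 n) 𝓘(ℝ) (f : M → ℝ) x :=
    f.contMDiff.mdifferentiable (by simp) x
  have hg : MDifferentiableAt (𝓡 n) 𝓘(ℝ) (g : M → ℝ) x :=
    g.contMDiff.mdifferentiable (by simp) x
  simp [mvfderiv_mul hf hg]

theorem act_real_smul_right (e : Sections n F E) (r : ℝ) (f : SmoothFun n M) :
    B.act e (r • f) = r • B.act e f := by
  ext x
  have hf : MDifferentiableAt (𝓡 n) 𝓘(ℝ) (f : M → ℝ) x :=
    f.contMDiff.mdifferentiable (by simp) x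
  have hr : MDifferentiableAt (𝓡 n) 𝓘(ℝ) (fun _ : M => r) x := mdifferentiableAt_const
  have : ((r • f : SmoothFun n M) : M → ℝ) = (fun _ : M => r) * (f : M → ℝ) := by
    ext y; simp
  simp [this, mvfderiv_mul hr hf, mvfderiv_const]

theorem act_neg_right (e : Sections n F E) (f : SmoothFun n M) :
    B.act e (-f) = -B.act e f := by
  have := B.act_real_smul_right e (-1) f
  simpa using this

end AnchoredMetric

end AnchoredMetricLemmas

section Courant

/-- A Courant algebroid `(E, ⟨·,·⟩, [·,·], ρ)` over `M`, with the (not necessarily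
skew-symmetric) bracket that satisfies the Jacobi identity in Leibniz form. -/
structure CourantAlgebroid (n : ℕ) {M : Type*} [TopologicalSpace M]
    [ChartedSpace (EuclideanSpace ℝ (Fin n)) M] [IsManifold (𝓡 n) ∞ M]
    (F : Type*) [NormedAddCommGroup F] [NormedSpace ℝ F]
    (E : M → Type*) [∀ x, AddCommGroup (E x)] [∀ x, Module ℝ (E x)]
    [∀ x, TopologicalSpace (E x)] [TopologicalSpace (Bundle.TotalSpace F E)]
    [FiberBundle F E] [VectorBundle ℝ F E] extends AnchoredMetric n F E where
  /-- the Courant bracket `[·,·]` on `Γ^∞(E)` -/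
  bracket : Sections n F E →ₗ[ℝ] Sections n F E →ₗ[ℝ] Sections n F E
  /-- `[e₁,[e₂,e₃]] = [[e₁,e₂],e₃] + [e₂,[e₁,e₃]]` -/
  jacobi : ∀ e₁ e₂ e₃,
    bracket e₁ (bracket e₂ e₃) = bracket (bracket e₁ e₂) e₃ + bracket e₂ (bracket e₁ e₃)
  /-- `[e₁,e₂] + [e₂,e₁] = 𝒟⟨e₁,e₂⟩`, where `𝒟 f` is the section determined by
  `⟨𝒟 f, e⟩ = ρ(e) f` for all `e` -/
  bracket_symm : ∀ e₁ e₂ e,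
    toAnchoredMetric.pair (bracket e₁ e₂ + bracket e₂ e₁) e =
      toAnchoredMetric.act e (toAnchoredMetric.pair e₁ e₂)
  /-- `ρ(e₁)⟨e₂,e₃⟩ = ⟨[e₁,e₂],e₃⟩ + ⟨e₂,[e₁,e₃]⟩` -/
  act_pair : ∀ e₁ e₂ e₃,
    toAnchoredMetric.act e₁ (toAnchoredMetric.pair e₂ e₃) =
      toAnchoredMetric.pair (bracket e₁ e₂) e₃ + toAnchoredMetric.pair e₂ (bracket e₁ e₃)

variable {n : ℕ} {M : Type*} [TopologicalSpace M] [ChartedSpace (EuclideanSpace ℝ (Fin n)) M]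
  {F : Type*} [NormedAddCommGroup F] [NormedSpace ℝ F]
  {E : M → Type*} [∀ x, AddCommGroup (E x)] [∀ x, Module ℝ (E x)]
  [∀ x, TopologicalSpace (E x)] [TopologicalSpace (Bundle.TotalSpace F E)]
  [FiberBundle F E] [VectorBundle ℝ F E]

variable (n F) in
/-- A family of subspaces `L x ⊆ E x` is a smooth subbundle of `E`: around every point there is a
frame of `L` consisting of local smooth sections of `E`. -/
def IsSubbundle (L : ∀ x, Submodule ℝ (E x)) : Prop :=
  ∀ x₀ : M, ∃ U : Set M, IsOpen U ∧ x₀ ∈ U ∧ ∃ (r : ℕ) (s : Fin r → ∀ x, E x),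
    (∀ i, ContMDiffOn (𝓡 n) ((𝓡 n).prod 𝓘(ℝ, F)) ∞
      (fun x => (⟨x, s i x⟩ : Bundle.TotalSpace F E)) U) ∧
    ∀ x ∈ U, LinearIndependent ℝ (fun i => s i x) ∧
      Submodule.span ℝ (Set.range fun i => s i x) = L x

variable (n F) in
/-- The `C^∞(M)`-module `Γ^∞(L)` of smooth sections of `E` with values in `L`. -/
def sectionsOf (L : ∀ x, Submodule ℝ (E x)) : Submodule (SmoothFun n M) (Sections n F E) where
  carrier := {s | ∀ x, s x ∈ L x}
  add_mem' hs ht x := (L x).add_mem (hs x) (ht x)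
  zero_mem' x := (L x).zero_mem
  smul_mem' f _ hs x := (L x).smul_mem (f x) (hs x)

variable [IsManifold (𝓡 n) ∞ M]

/-- A Dirac structure in a Courant algebroid: a smooth subbundle `L ⊆ E` that is maximally
isotropic and whose sections are closed under the Courant bracket. -/
structure DiracStructure (C : CourantAlgebroid n F E) where
  L : ∀ x, Submodule ℝ (E x)
  subbundle : IsSubbundle n F L
  isotropic : ∀ x, ∀ u ∈ L x, ∀ v ∈ L x, C.form x u v = 0
  maximal : ∀ x (W : Submodule ℝ (E x)), (∀ u ∈ W, ∀ v ∈ W, C.form x u v = 0) →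
    L x ≤ W → W = L x
  closed : ∀ s₁ ∈ sectionsOf n F L, ∀ s₂ ∈ sectionsOf n F L,
    C.bracket s₁ s₂ ∈ sectionsOf n F L

/-- An isotropic complement of a Dirac structure `L`: an isotropic smooth subbundle `L'` with
`E = L ⊕ L'`. The bilinear form identifies `L'` with `L^*`. -/
structure IsotropicComplement {C : CourantAlgebroid n F E} (D : DiracStructure C) where
  L' : ∀ x, Submodule ℝ (E x)
  subbundle : IsSubbundle n F L'
  isotropic : ∀ x, ∀ u ∈ L' x, ∀ v ∈ L' x, C.form x u v = 0
  isCompl : ∀ x, IsCompl (D.L x) (L' x)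

end Courant

section Duality

variable {n : ℕ} {M : Type*} [TopologicalSpace M] [ChartedSpace (EuclideanSpace ℝ (Fin n)) M]
  [IsManifold (𝓡 n) ∞ M]
  {F : Type*} [NormedAddCommGroup F] [NormedSpace ℝ F]
  {E : M → Type*} [∀ x, AddCommGroup (E x)] [∀ x, Module ℝ (E x)]
  [∀ x, TopologicalSpace (E x)] [TopologicalSpace (Bundle.TotalSpace F E)]
  [FiberBundle F E] [VectorBundle ℝ F E]
  {C : CourantAlgebroid n F E} {D : DiracStructure C}

open Topology Filter

theorem IsotropicComplement.form_zero_right (S : IsotropicComplement D) {x : M} {v : E x}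
    (hv : v ∈ S.L' x) (h : ∀ u ∈ D.L x, C.form x u v = 0) : v = 0 := by
  refine C.form_nondegenerate x v fun e => ?_
  obtain ⟨u, hu, u', hu', rfl⟩ := Submodule.mem_sup.1
    ((S.isCompl x).sup_eq_top ▸ (Submodule.mem_top : e ∈ ⊤))
  rw [map_add, C.form_symm x v u, h u hu, S.isotropic x v hv u' hu', add_zero]

theorem IsotropicComplement.form_zero_left (S : IsotropicComplement D) {x : M} {u : E x}
    (hu : u ∈ D.L x) (h : ∀ v ∈ S.L' x, C.form x v u = 0) : u = 0 := by
  refine C.form_nondegenerate x u fun e => ?_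
  obtain ⟨w, hw, v, hv, rfl⟩ := Submodule.mem_sup.1
    ((S.isCompl x).sup_eq_top ▸ (Submodule.mem_top : e ∈ ⊤))
  rw [map_add, C.form_symm x u v, h v hv, D.isotropic x u hu w hw, add_zero]

variable [T2Space M]

/-- A local frame of a subbundle is, after shrinking, given by global sections. -/
theorem IsSubbundle.exists_frame {L : ∀ x, Submodule ℝ (E x)} (hL : IsSubbundle n F L) (x₀ : M) :
    ∃ (r : ℕ) (s : Fin r → sectionsOf n F L), ∀ᶠ x in 𝓝 x₀,
      LinearIndependent ℝ (fun i => (s i : Sections n F E) x) ∧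
      Submodule.span ℝ (Set.range fun i => (s i : Sections n F E) x) = L x := by
  obtain ⟨U, hU, hx, r, s, hs, hf⟩ := hL x₀
  obtain ⟨χ, -, hχ⟩ := (SmoothBumpFunction.nhds_basis_tsupport (I := 𝓡 n) x₀).mem_iff.1
    (hU.mem_nhds hx)
  have hsm : ∀ i, ContMDiff (𝓡 n) ((𝓡 n).prod 𝓘(ℝ, F)) ∞
      (fun x => (⟨x, (χ x • s i x)⟩ : Bundle.TotalSpace F E)) := fun i =>
    ContMDiffOn.smul_section_of_tsupport (χ.contMDiff.contMDiffOn) hU hχ (hs i)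
  refine ⟨r, fun i => ⟨⟨fun x => χ x • s i x, hsm i⟩, fun x => ?_⟩, ?_⟩
  · by_cases hxU : x ∈ U
    · refine (L x).smul_mem _ ?_
      rw [← (hf x hxU).2]
      exact Submodule.subset_span ⟨i, rfl⟩
    · have : χ x = 0 := image_eq_zero_of_notMem_tsupport (fun h => hxU (hχ h))
      change χ x • s i x ∈ L x
      rw [this, zero_smul]; exact (L x).zero_mem
  · filter_upwards [χ.eventuallyEq_one, hU.mem_nhds hx] with x h1 h2
    have : (fun i => (χ x • s i x)) = fun i => s i x := by
      funext i; rw [h1]; simp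
    change LinearIndependent ℝ (fun i => (χ x • s i x)) ∧
      Submodule.span ℝ (Set.range (fun i => (χ x • s i x))) = L x
    rw [this]
    exact hf x h2

/-- A `C^∞(M)`-linear functional on sections is local. -/
theorem dual_apply_eq_zero {L : ∀ x, Submodule ℝ (E x)}
    (φ : Module.Dual (SmoothFun n M) (sectionsOf n F L)) (z : sectionsOf n F L) (x₀ : M)
    (hz : ∀ᶠ x in 𝓝 x₀, (z : Sections n F E) x = 0) : φ z x₀ = 0 := by
  obtain ⟨χ, -, hχ⟩ := (SmoothBumpFunction.nhds_basis_tsupport (I := 𝓡 n) x₀).mem_iff.1 hz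
  let g : SmoothFun n M := ⟨χ, χ.contMDiff⟩
  have h0 : g • z = 0 := by
    ext x
    change χ x • (z : Sections n F E) x = 0
    by_cases hx : x ∈ tsupport χ
    · have : (z : Sections n F E) x = 0 := hχ hx
      rw [this, smul_zero]
    · rw [image_eq_zero_of_notMem_tsupport hx, zero_smul]
  have h1 : g * φ z = 0 := by rw [← smul_eq_mul, ← map_smul, h0, map_zero]
  have h2 : χ x₀ * φ z x₀ = 0 := congrArg (fun f : SmoothFun n M => f x₀) h1
  rwa [χ.eq_one, one_mul] at h2

namespace IsotropicComplement

variable (S : IsotropicComplement D)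

/-- Local representation of a `C^∞(M)`-linear functional on `Γ^∞(L)` by a section of `L'`. -/
theorem exists_local_rep (φ : Module.Dual (SmoothFun n M) (sectionsOf n F D.L)) (x₀ : M) :
    ∃ (w : sectionsOf n F S.L') (δ : SmoothFun n M), δ x₀ ≠ 0 ∧ ∀ᶠ x in 𝓝 x₀,
      ∀ s : sectionsOf n F D.L,
        δ x * φ s x = C.form x ((w : Sections n F E) x) ((s : Sections n F E) x) := by
  obtain ⟨r, s, hs⟩ := D.subbundle.exists_frame x₀
  obtain ⟨r', t, ht⟩ := S.subbundle.exists_frame x₀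
  have hrr : r = r' := by
    have hs0 := hs.self_of_nhds
    have ht0 := ht.self_of_nhds
    apply le_antisymm
    · have h : LinearIndependent ℝ (fun i : Fin r => fun j : Fin r' =>
          C.form x₀ ((t j : Sections n F E) x₀) ((s i : Sections n F E) x₀)) := by
        rw [Fintype.linearIndependent_iff] at hs0 ⊢
        intro g hg
        apply hs0.1
        apply S.form_zero_left
        · exact Submodule.sum_mem _ fun i _ => Submodule.smul_mem _ _ ((s i).2 x₀)
        · intro v hv
          rw [← ht0.2] at hv
          induction hv using Submodule.span_induction with
          | mem v hv =>
            obtain ⟨j, rfl⟩ := hv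
            have := congrFun hg j
            simpa [map_sum, Finset.sum_apply] using this
          | zero => simp
          | add a b _ _ ha hb => rw [map_add, LinearMap.add_apply, ha, hb, add_zero]
          | smul c a _ ha => rw [map_smul, LinearMap.smul_apply, ha, smul_zero]
      simpa using h.fintype_card_le_finrank
    · have h : LinearIndependent ℝ (fun j : Fin r' => fun i : Fin r =>
          C.form x₀ ((s i : Sections n F E) x₀) ((t j : Sections n F E) x₀)) := by
        rw [Fintype.linearIndependent_iff] at ht0 ⊢
        intro g hg
        apply ht0.1
        apply S.form_zero_right
        · exact Submodule.sum_mem _ fun i _ => Submodule.smul_mem _ _ ((t i).2 x₀)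
        · intro v hv
          rw [← hs0.2] at hv
          induction hv using Submodule.span_induction with
          | mem v hv =>
            obtain ⟨j, rfl⟩ := hv
            have := congrFun hg j
            simpa [map_sum, Finset.sum_apply] using this
          | zero => simp
          | add a b _ _ ha hb => rw [map_add, LinearMap.add_apply, ha, hb, add_zero]
          | smul c a _ ha => rw [map_smul, LinearMap.smul_apply, ha, smul_zero]
      simpa using h.fintype_card_le_finrank
  subst hrr
  let P : Matrix (Fin r) (Fin r) (SmoothFun n M) := fun i j =>
    C.pair (t j : Sections n F E) (s i : Sections n F E)
  let w : sectionsOf n F S.L' := ∑ j, (∑ i, P.adjugate j i * φ (s i)) • t j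
  refine ⟨w, P.det, ?_, ?_⟩
  · have hs0 := hs.self_of_nhds
    have ht0 := ht.self_of_nhds
    have hdet : P.det x₀ = ((ContMDiffMap.evalRingHom x₀).mapMatrix P).det := by
      rw [← RingHom.map_det]; rfl
    rw [hdet]
    intro h0
    obtain ⟨c, hc, hPc⟩ := Matrix.exists_mulVec_eq_zero_iff.2 h0
    apply hc
    rw [Fintype.linearIndependent_iff] at ht0
    funext k
    refine ht0.1 c ?_ k
    apply S.form_zero_right
    · exact Submodule.sum_mem _ fun i _ => Submodule.smul_mem _ _ ((t i).2 x₀)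
    · intro v hv
      rw [← hs0.2] at hv
      induction hv using Submodule.span_induction with
      | mem v hv =>
        obtain ⟨i, rfl⟩ := hv
        have := congrFun hPc i
        simp only [Matrix.mulVec, dotProduct, Pi.zero_apply] at this
        rw [map_sum, ← this]
        refine Finset.sum_congr rfl fun j _ => ?_
        rw [map_smul, smul_eq_mul, mul_comm, C.form_symm]
        rfl
      | zero => simp
      | add a b _ _ ha hb => rw [map_add, LinearMap.add_apply, ha, hb, add_zero]
      | smul c a _ ha => rw [map_smul, LinearMap.smul_apply, ha, smul_zero]
  · filter_upwards [(hs.and ht).eventually_nhds] with x hx u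
    let a : Fin r → SmoothFun n M := fun i => ∑ j, C.pair (t j : Sections n F E) u * P.adjugate j i
    let z : sectionsOf n F D.L := P.det • u - ∑ i, a i • s i
    have hpair : ∀ k, C.pair (t k : Sections n F E) (z : Sections n F E) = 0 := by
      intro k
      have hadj : ∀ j, ∑ i, P i k * P.adjugate j i = if j = k then P.det else 0 := by
        intro j
        have := congrFun (congrFun P.adjugate_mul j) k
        rw [Matrix.mul_apply, Matrix.smul_apply, Matrix.one_apply] at this
        simpa [mul_comm] using this
      have hcoe : (z : Sections n F E) = P.det • (u : Sections n F E) -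
          ∑ i, a i • (s i : Sections n F E) := by
        simp [z]
      rw [hcoe, ← C.pairLM_apply, map_sub, map_smul, map_sum]
      simp only [smul_eq_mul, C.pairLM_apply, C.pair_smul_right]
      have : ∑ i, a i * C.pair (t k : Sections n F E) (s i : Sections n F E) =
          ∑ j, C.pair (t j : Sections n F E) u * ∑ i, P i k * P.adjugate j i := by
        simp only [a, Finset.sum_mul, Finset.mul_sum]
        rw [Finset.sum_comm]
        refine Finset.sum_congr rfl fun j _ => Finset.sum_congr rfl fun i _ => ?_
        change _ * C.pair _ _ = _ * (C.pair _ _ * _)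
        ring
      rw [this]
      simp only [hadj, mul_ite, mul_zero, Finset.sum_ite_eq', Finset.mem_univ, if_true]
      ring
    have hz : ∀ᶠ y in 𝓝 x, (z : Sections n F E) y = 0 := by
      filter_upwards [hx] with y hy
      apply S.form_zero_left (z.2 y)
      intro v hv
      rw [← hy.2.2] at hv
      induction hv using Submodule.span_induction with
      | mem v hv =>
        obtain ⟨k, rfl⟩ := hv
        exact congrArg (fun f : SmoothFun n M => f y) (hpair k)
      | zero => simp
      | add a b _ _ ha hb => rw [map_add, LinearMap.add_apply, ha, hb, add_zero]
      | smul c a _ ha => rw [map_smul, LinearMap.smul_apply, ha, smul_zero]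
    have h1 := dual_apply_eq_zero φ z x hz
    have h2 : φ z = P.det * φ u - C.pair (w : Sections n F E) (u : Sections n F E) := by
      have hcoe : (w : Sections n F E) =
          ∑ j, (∑ i, P.adjugate j i * φ (s i)) • (t j : Sections n F E) := by
        simp [w]
      rw [hcoe, C.pair_comm, ← C.pairLM_apply, map_sum]
      simp only [z, map_sub, map_smul, map_sum, smul_eq_mul, C.pairLM_apply]
      congr 1
      simp only [a, Finset.sum_mul, C.pair_smul_right]
      rw [Finset.sum_comm]
      refine Finset.sum_congr rfl fun j _ => Finset.sum_congr rfl fun i _ => ?_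
      rw [C.pair_comm (u : Sections n F E)]
      ring
    have h3 : P.det x * φ u x - C.pair (w : Sections n F E) (u : Sections n F E) x = 0 := by
      rw [← h1, h2]; rfl
    exact sub_eq_zero.1 h3

theorem exists_rep (φ : Module.Dual (SmoothFun n M) (sectionsOf n F D.L)) :
    ∃ v : sectionsOf n F S.L', ∀ s : sectionsOf n F D.L,
      C.pair (v : Sections n F E) (s : Sections n F E) = φ s := by
  choose w δ hδ h using S.exists_local_rep φ
  let v : ∀ x, E x := fun x => (δ x x)⁻¹ • (w x : Sections n F E) x
  have hvL : ∀ x, v x ∈ S.L' x := fun x => (S.L' x).smul_mem _ ((w x).2 x)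
  have hv : ∀ x (s : sectionsOf n F D.L), C.form x (v x) ((s : Sections n F E) x) = φ s x := by
    intro x s
    have := (h x).self_of_nhds s
    simp only [v, map_smul, LinearMap.smul_apply, smul_eq_mul]
    rw [← this, inv_mul_cancel_left₀ (hδ x)]
  have hloc : ∀ x₀, ∀ᶠ x in 𝓝 x₀, v x = (δ x₀ x)⁻¹ • (w x₀ : Sections n F E) x := by
    intro x₀
    have hne : ∀ᶠ x in 𝓝 x₀, δ x₀ x ≠ 0 :=
      (δ x₀).contMDiff.continuous.continuousAt.eventually_ne (hδ x₀)
    obtain ⟨r, s, hs⟩ := D.subbundle.exists_frame x₀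
    filter_upwards [hne, hs, h x₀] with x h1 h2 h3
    rw [← sub_eq_zero]
    apply S.form_zero_right ((S.L' x).sub_mem (hvL x) ((S.L' x).smul_mem _ ((w x₀).2 x)))
    intro u hu
    rw [← h2.2] at hu
    induction hu using Submodule.span_induction with
    | mem u hu =>
      obtain ⟨i, rfl⟩ := hu
      rw [C.form_symm, map_sub, LinearMap.sub_apply, hv x (s i), map_smul, LinearMap.smul_apply, smul_eq_mul,
        ← h3 (s i), inv_mul_cancel_left₀ h1, sub_self]
    | zero => simp
    | add a b _ _ ha hb => rw [map_add, LinearMap.add_apply, ha, hb, add_zero]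
    | smul c a _ ha => rw [map_smul, LinearMap.smul_apply, ha, smul_zero]
  have hsm : ContMDiff (𝓡 n) ((𝓡 n).prod 𝓘(ℝ, F)) ∞
      (fun x => (⟨x, v x⟩ : Bundle.TotalSpace F E)) := by
    intro x₀
    have h1 : ContMDiffAt (𝓡 n) 𝓘(ℝ) ∞ (fun x => (δ x₀ x)⁻¹) x₀ :=
      ((δ x₀).contMDiff x₀).inv₀ (hδ x₀)
    have h2 := h1.smul_section ((w x₀ : Sections n F E).contMDiff x₀)
    refine h2.congr_of_eventuallyEq ?_
    filter_upwards [hloc x₀] with x hx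
    rw [hx]; rfl
  refine ⟨⟨⟨v, hsm⟩, hvL⟩, fun s => ?_⟩
  ext x
  exact hv x s

theorem rep_unique {v v' : sectionsOf n F S.L'}
    (h : ∀ s : sectionsOf n F D.L, C.pair (v : Sections n F E) (s : Sections n F E) =
      C.pair (v' : Sections n F E) (s : Sections n F E)) : v = v' := by
  ext x
  obtain ⟨r, s, hs⟩ := D.subbundle.exists_frame x
  rw [← sub_eq_zero]
  apply S.form_zero_right ((S.L' x).sub_mem (v.2 x) (v'.2 x))
  intro u hu
  rw [← hs.self_of_nhds.2] at hu
  induction hu using Submodule.span_induction with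
  | mem u hu =>
    obtain ⟨i, rfl⟩ := hu
    rw [C.form_symm, map_sub, LinearMap.sub_apply, sub_eq_zero]
    exact congrArg (fun f : SmoothFun n M => f x) (h (s i))
  | zero => simp
  | add a b _ _ ha hb => rw [map_add, LinearMap.add_apply, ha, hb, add_zero]
  | smul c a _ ha => rw [map_smul, LinearMap.smul_apply, ha, smul_zero]

/-- The identification `Γ^∞(L^*) ≅ Γ^∞(L')` given by the bilinear form: `ofDual φ` is the
section of `L'` with `⟨ofDual φ, s⟩ = φ(s)` for all `s ∈ Γ^∞(L)`. -/
def ofDual : Module.Dual (SmoothFun n M) (sectionsOf n F D.L) →ₗ[SmoothFun n M]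
    sectionsOf n F S.L' where
  toFun φ := (S.exists_rep φ).choose
  map_add' φ φ' := S.rep_unique fun s => by
    rw [(S.exists_rep _).choose_spec, Submodule.coe_add, C.pair_add_left,
      (S.exists_rep φ).choose_spec, (S.exists_rep φ').choose_spec]; rfl
  map_smul' f φ := S.rep_unique fun s => by
    rw [(S.exists_rep _).choose_spec]
    change f * φ s = C.pair (f • ((S.exists_rep φ).choose : Sections n F E)) _
    rw [C.pair_smul_left, (S.exists_rep φ).choose_spec]

theorem pair_ofDual (φ : Module.Dual (SmoothFun n M) (sectionsOf n F D.L))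
    (s : sectionsOf n F D.L) :
    C.pair (S.ofDual φ : Sections n F E) (s : Sections n F E) = φ s :=
  (S.exists_rep φ).choose_spec s

end IsotropicComplement
end Duality

section LieAlgebroidComplex

variable {A V : Type*} [CommRing A] [AddCommGroup V] [Module A V]

/-- The Chevalley-Eilenberg formula
`(dη)(v₀,…,v_{k+1}) = ∑_i (-1)^i ρ(v_i) η(…,v̂_i,…)
  + ∑_{i<j} (-1)^{i+j} η([v_i,v_j],…,v̂_i,…,v̂_j,…)`.
A pair `i < j` of indices is written `(i.castSucc, j.succ)` with `i ≤ j`, which produces the sign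
in front of the second sum. -/
def chevalleyEilenberg (ρ : V → A → A) (br : V → V → V) {k : ℕ}
    (η : V [⋀^Fin (k + 1)]→ₗ[A] A) (v : Fin (k + 2) → V) : A :=
  (∑ i : Fin (k + 2), (-1 : ℤ) ^ (i : ℕ) • ρ (v i) (η (i.removeNth v))) -
    ∑ i : Fin (k + 1), ∑ j ≥ i, (-1 : ℤ) ^ (i + j : ℕ) •
      η (Matrix.vecCons (br (v i.castSucc) (v j.succ)) (j.removeNth (i.castSucc.removeNth v)))

theorem chevalleyEilenberg_smul (ρ : V → A → A) (br : V → V → V)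
    (hρ : ∀ (a : A) x f, ρ (a • x) f = a * ρ x f)
    (hder : ∀ x f g, ρ x (f * g) = f * ρ x g + g * ρ x f)
    (hbr : ∀ (a : A) x y, br (a • x) y = a • br x y - ρ y a • x)
    {k : ℕ} (η : V [⋀^Fin (k + 1)]→ₗ[A] A) (a : A) (x : V) (v : Fin (k + 1) → V) :
    chevalleyEilenberg ρ br η (Matrix.vecCons (a • x) v) =
      a * chevalleyEilenberg ρ br η (Matrix.vecCons x v) := by
  have hrem : ∀ {m : ℕ} (p : Fin (m + 1)) (y : V) (u : Fin (m + 1) → V),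
      p.succ.removeNth (Matrix.vecCons y u) = Matrix.vecCons y (p.removeNth u) := by
    intro m p y u
    funext l
    refine Fin.cases ?_ (fun l => ?_) l <;> simp [Fin.removeNth]
  have hη : ∀ {m : ℕ} (θ : V [⋀^Fin (m + 1)]→ₗ[A] A) (b : A) (y : V) (u : Fin m → V),
      θ (Matrix.vecCons (b • y) u) = b * θ (Matrix.vecCons y u) := by
    intro m θ b y u
    exact θ.toMultilinearMap.cons_smul u b y
  have hη2 : ∀ (y z : V) (u : Fin k → V),
      η (Matrix.vecCons (y - z) u) = η (Matrix.vecCons y u) - η (Matrix.vecCons z u) := by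
    intro y z u
    have h1 := η.toMultilinearMap.cons_add u (y - z) z
    rw [sub_add_cancel] at h1
    exact (sub_eq_of_eq_add h1).symm
  have hrest : ∀ i : Fin k, ∀ j ≥ i.succ,
      η (Matrix.vecCons (br (Matrix.vecCons (a • x) v i.succ.castSucc)
          (Matrix.vecCons (a • x) v j.succ))
          (j.removeNth (i.succ.castSucc.removeNth (Matrix.vecCons (a • x) v)))) =
        a * η (Matrix.vecCons (br (Matrix.vecCons x v i.succ.castSucc)
          (Matrix.vecCons x v j.succ))
          (j.removeNth (i.succ.castSucc.removeNth (Matrix.vecCons x v)))) := by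
    intro i j hj
    obtain ⟨m, rfl⟩ : ∃ m, k = m + 1 := ⟨k - 1, by have := i.pos; omega⟩
    obtain ⟨j', rfl⟩ := Fin.exists_succ_eq.2 (show j ≠ 0 from fun h => by simp [h] at hj)
    rw [Fin.castSucc_succ i, hrem, hrem, hrem, hrem]
    simp only [Matrix.cons_val_succ]
    have := hη (η.curryLeft (br (v i.castSucc) (v j'.succ))) a x
      (j'.removeNth (i.castSucc.removeNth v))
    exact this
  have h1 : ∀ y : V, ∑ i : Fin (k + 2), (-1 : ℤ) ^ (i : ℕ) •
      ρ (Matrix.vecCons y v i) (η (i.removeNth (Matrix.vecCons y v))) =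
      ρ y (η v) + ∑ p : Fin (k + 1), (-1 : ℤ) ^ (p + 1 : ℕ) •
        ρ (v p) (η (Matrix.vecCons y (p.removeNth v))) := by
    intro y
    rw [Fin.sum_univ_succ]
    simp only [hrem, Matrix.cons_val_succ, Fin.val_succ]
    simp
  have h2 : ∀ y : V, ∑ j ≥ (0 : Fin (k + 1)), (-1 : ℤ) ^ ((0 : Fin (k + 1)) + j : ℕ) •
      η (Matrix.vecCons (br (Matrix.vecCons y v (0 : Fin (k + 1)).castSucc)
        (Matrix.vecCons y v j.succ))
        (j.removeNth ((0 : Fin (k + 1)).castSucc.removeNth (Matrix.vecCons y v)))) =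
      ∑ p : Fin (k + 1), (-1 : ℤ) ^ (p : ℕ) •
        η (Matrix.vecCons (br y (v p)) (p.removeNth v)) := by
    intro y
    have : Finset.Ici (0 : Fin (k + 1)) = Finset.univ := by ext; simp
    rw [this]
    refine Finset.sum_congr rfl fun p _ => ?_
    simp only [Matrix.cons_val_succ, Fin.val_zero, zero_add]
    rfl
  have h2s : ∀ y : V, ∑ i : Fin (k + 1), ∑ j ≥ i, (-1 : ℤ) ^ (i + j : ℕ) •
      η (Matrix.vecCons (br (Matrix.vecCons y v i.castSucc) (Matrix.vecCons y v j.succ))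
        (j.removeNth (i.castSucc.removeNth (Matrix.vecCons y v)))) =
      ∑ p : Fin (k + 1), (-1 : ℤ) ^ (p : ℕ) •
        η (Matrix.vecCons (br y (v p)) (p.removeNth v)) +
      ∑ i : Fin k, ∑ j ≥ i.succ, (-1 : ℤ) ^ (i.succ + j : ℕ) •
      η (Matrix.vecCons (br (Matrix.vecCons y v i.succ.castSucc)
        (Matrix.vecCons y v j.succ))
        (j.removeNth (i.succ.castSucc.removeNth (Matrix.vecCons y v)))) := by
    intro y
    rw [Fin.sum_univ_succ, h2]
  simp only [chevalleyEilenberg]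
  rw [h1, h1, h2s, h2s]
  have h3 : ∑ i : Fin k, ∑ j ≥ i.succ, (-1 : ℤ) ^ (i.succ + j : ℕ) •
      η (Matrix.vecCons (br (Matrix.vecCons (a • x) v i.succ.castSucc)
        (Matrix.vecCons (a • x) v j.succ))
        (j.removeNth (i.succ.castSucc.removeNth (Matrix.vecCons (a • x) v)))) =
      a * ∑ i : Fin k, ∑ j ≥ i.succ, (-1 : ℤ) ^ (i.succ + j : ℕ) •
      η (Matrix.vecCons (br (Matrix.vecCons x v i.succ.castSucc)
        (Matrix.vecCons x v j.succ))
        (j.removeNth (i.succ.castSucc.removeNth (Matrix.vecCons x v)))) := by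
    simp only [Finset.mul_sum]
    refine Finset.sum_congr rfl fun i _ => Finset.sum_congr rfl fun j hj => ?_
    rw [hrest i j (Finset.mem_Ici.1 hj), mul_smul_comm]
  rw [h3, hρ]
  simp only [hbr, hη2, hη, hder, smul_add, smul_sub, Finset.sum_add_distrib,
    Finset.sum_sub_distrib, mul_add, mul_sub, Finset.mul_sum, mul_smul_comm]
  have h4 : ∑ p : Fin (k + 1), (-1 : ℤ) ^ (p + 1 : ℕ) •
      (η (Matrix.vecCons x (p.removeNth v)) * ρ (v p) a) =
      -∑ p : Fin (k + 1), (-1 : ℤ) ^ (p : ℕ) •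
      (ρ (v p) a * η (Matrix.vecCons x (p.removeNth v))) := by
    rw [← Finset.sum_neg_distrib]
    refine Finset.sum_congr rfl fun p _ => ?_
    rw [pow_succ, mul_neg_one, neg_smul, mul_comm]
  rw [h4]
  abel

variable [Algebra ℝ A] [Module ℝ V] [IsScalarTower ℝ A V]

/-- An `ℝ`-alternating map that is `A`-homogeneous in the first slot is `A`-alternating. -/
def mkAlternating {m : ℕ} (f : V [⋀^Fin (m + 1)]→ₗ[ℝ] A)
    (hf : ∀ (a : A) (x : V) (v : Fin m → V),
      f (Matrix.vecCons (a • x) v) = a * f (Matrix.vecCons x v)) :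
    V [⋀^Fin (m + 1)]→ₗ[A] A where
  toFun := f
  map_update_add' v i x y := by
    convert f.map_update_add v i x y
  map_update_smul' v i a x := by
    have h : ∀ y, Function.update v i y = i.insertNth y (i.removeNth v) := fun y => by
      rw [Fin.insertNth_removeNth]; congr!
    rw [h, h, AlternatingMap.map_insertNth, AlternatingMap.map_insertNth, hf, smul_eq_mul,
      mul_smul_comm]
  map_eq_zero_of_eq' v i j h hij := f.map_eq_zero_of_eq v h hij

/-- Restriction of scalars of an alternating map, `ℝ`-linearly. -/
def restrictAlternating (k : ℕ) : V [⋀^Fin k]→ₗ[A] A →ₗ[ℝ] V [⋀^Fin k]→ₗ[ℝ] A where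
  toFun η :=
    { toFun := η
      map_update_add' := fun v i x y => by convert η.map_update_add v i x y
      map_update_smul' := fun v i a x => by
        rw [← algebraMap_smul A a x, η.map_update_smul, algebraMap_smul]
      map_eq_zero_of_eq' := fun v _ _ h hij => η.map_eq_zero_of_eq v h hij }
  map_add' _ _ := rfl
  map_smul' _ _ := rfl

/-- The Chevalley-Eilenberg formula as an `ℝ`-alternating map. -/
def chevalleyEilenbergReal (ρ : V →ₗ[ℝ] A →ₗ[ℝ] A) (br : V →ₗ[ℝ] V →ₗ[ℝ] V) {k : ℕ}
    (η : V [⋀^Fin (k + 1)]→ₗ[ℝ] A) : V [⋀^Fin (k + 2)]→ₗ[ℝ] A :=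
  AlternatingMap.alternatizeUncurryFin
    ({ toFun := fun x => (ρ x).compAlternatingMap η
       map_add' := fun x y => by ext; simp
       map_smul' := fun c x => by ext; simp } : V →ₗ[ℝ] V [⋀^Fin (k + 1)]→ₗ[ℝ] A) -
  (1 / 2 : ℝ) • AlternatingMap.alternatizeUncurryFin
    (AlternatingMap.alternatizeUncurryFinLM ∘ₗ br.compr₂ η.curryLeft)

theorem chevalleyEilenbergReal_apply (ρ : V →ₗ[ℝ] A →ₗ[ℝ] A) (br : V →ₗ[ℝ] V →ₗ[ℝ] V)
    (hskew : ∀ x y, br x y = -br y x) {k : ℕ} (η : V [⋀^Fin (k + 1)]→ₗ[A] A)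
    (v : Fin (k + 2) → V) :
    chevalleyEilenbergReal ρ br (restrictAlternating (k + 1) η) v =
      chevalleyEilenberg (fun x f => ρ x f) (fun x y => br x y) η v := by
  rw [chevalleyEilenbergReal, AlternatingMap.sub_apply, AlternatingMap.smul_apply,
    AlternatingMap.alternatizeUncurryFin_apply,
    AlternatingMap.alternatizeUncurryFin_alternatizeUncurryFinLM_comp_apply]
  simp only [chevalleyEilenberg]
  congr 1
  rw [Finset.smul_sum]
  refine Finset.sum_congr rfl fun i _ => ?_
  rw [Finset.smul_sum]
  refine Finset.sum_congr rfl fun j _ => ?_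
  rw [smul_comm]
  congr 1
  simp only [LinearMap.compr₂_apply]
  rw [hskew (v j.succ) (v i.castSucc), map_neg, AlternatingMap.neg_apply, sub_neg_eq_add,
    ← two_smul ℝ, smul_smul]
  norm_num
  rfl

/-- The differential on alternating forms of degree `≥ 1`, given by the Chevalley-Eilenberg
formula. -/
def chevalleyEilenbergLM (ρ : V →ₗ[ℝ] A →ₗ[ℝ] A) (br : V →ₗ[ℝ] V →ₗ[ℝ] V)
    (hρ : ∀ (a : A) x f, ρ (a • x) f = a * ρ x f)
    (hder : ∀ x f g, ρ x (f * g) = f * ρ x g + g * ρ x f)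
    (hskew : ∀ x y, br x y = -br y x)
    (hbr : ∀ (a : A) x y, br (a • x) y = a • br x y - ρ y a • x) (k : ℕ) :
    V [⋀^Fin (k + 1)]→ₗ[A] A →ₗ[ℝ] V [⋀^Fin (k + 2)]→ₗ[A] A where
  toFun η := mkAlternating (chevalleyEilenbergReal ρ br (restrictAlternating (k + 1) η))
    fun a x v => by
      rw [chevalleyEilenbergReal_apply ρ br hskew, chevalleyEilenbergReal_apply ρ br hskew]
      exact chevalleyEilenberg_smul _ _ hρ hder hbr η a x v
  map_add' η θ := by
    ext v
    change chevalleyEilenbergReal ρ br (restrictAlternating (k + 1) (η + θ)) v =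
      chevalleyEilenbergReal ρ br (restrictAlternating (k + 1) η) v +
      chevalleyEilenbergReal ρ br (restrictAlternating (k + 1) θ) v
    rw [chevalleyEilenbergReal_apply ρ br hskew, chevalleyEilenbergReal_apply ρ br hskew,
      chevalleyEilenbergReal_apply ρ br hskew]
    simp only [chevalleyEilenberg, AlternatingMap.add_apply, map_add, smul_add,
      Finset.sum_add_distrib]
    abel
  map_smul' c η := by
    ext v
    change chevalleyEilenbergReal ρ br (restrictAlternating (k + 1) (c • η)) v =
      c • chevalleyEilenbergReal ρ br (restrictAlternating (k + 1) η) v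
    rw [chevalleyEilenbergReal_apply ρ br hskew, chevalleyEilenbergReal_apply ρ br hskew]
    simp only [chevalleyEilenberg, AlternatingMap.smul_apply, map_smul, smul_sub, Finset.smul_sum]
    simp only [smul_comm c]

theorem chevalleyEilenbergLM_apply (ρ : V →ₗ[ℝ] A →ₗ[ℝ] A) (br : V →ₗ[ℝ] V →ₗ[ℝ] V)
    (hρ : ∀ (a : A) x f, ρ (a • x) f = a * ρ x f)
    (hder : ∀ x f g, ρ x (f * g) = f * ρ x g + g * ρ x f)
    (hskew : ∀ x y, br x y = -br y x)
    (hbr : ∀ (a : A) x y, br (a • x) y = a • br x y - ρ y a • x) {k : ℕ}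
    (η : V [⋀^Fin (k + 1)]→ₗ[A] A) (v : Fin (k + 2) → V) :
    chevalleyEilenbergLM ρ br hρ hder hskew hbr k η v =
      chevalleyEilenberg (fun x f => ρ x f) (fun x y => br x y) η v :=
  chevalleyEilenbergReal_apply ρ br hskew η v

end LieAlgebroidComplex

section AlternatingThree

variable {A V : Type*} [CommRing A] [Algebra ℝ A] [AddCommGroup V] [Module A V]

/-- A function that is `A`-linear in the first slot and changes its sign under the transpositions
of neighbouring slots is an alternating `A`-trilinear map. -/
def mkAlternatingThree (T : V → V → V → A) (hadd : ∀ a a' b c, T (a + a') b c = T a b c + T a' b c)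
    (hsmul : ∀ (f : A) a b c, T (f • a) b c = f * T a b c)
    (h12 : ∀ a b c, T a b c = -T b a c) (h23 : ∀ a b c, T a b c = -T a c b) :
    V [⋀^Fin 3]→ₗ[A] A :=
  have hself : ∀ x : A, x = -x → x = 0 := fun x hx => by
    have h2 : (2 : ℝ) • x = 0 := by rw [two_smul]; nth_rewrite 1 [hx]; exact neg_add_cancel x
    have := congrArg (fun y => (1 / 2 : ℝ) • y) h2
    simpa [smul_smul] using this
  have hadd2 : ∀ a b b' c, T a (b + b') c = T a b c + T a b' c := fun a b b' c => by
    rw [h12, hadd, h12 a b, h12 a b', neg_add]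
  have hsmul2 : ∀ (f : A) a b c, T a (f • b) c = f * T a b c := fun f a b c => by
    rw [h12, hsmul, h12 a b, mul_neg]
  { toFun := fun v => T (v 0) (v 1) (v 2)
    map_update_add' := by
      intro inst v i x y
      obtain rfl : inst = instDecidableEqFin 3 := Subsingleton.elim _ _
      fin_cases i
      · simp [Function.update_of_ne, hadd]
      · simp [Function.update_of_ne, hadd2]
      · simp only [Fin.reduceFinMk, ne_eq, Fin.reduceEq, not_false_eq_true,
          Function.update_of_ne, Function.update_self]
        rw [h23, hadd2, h23 _ _ x, h23 _ _ y, neg_add]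
    map_update_smul' := by
      intro inst v i f x
      obtain rfl : inst = instDecidableEqFin 3 := Subsingleton.elim _ _
      fin_cases i
      · simp [Function.update_of_ne, hsmul]
      · simp [Function.update_of_ne, hsmul2]
      · simp only [Fin.reduceFinMk, ne_eq, Fin.reduceEq, not_false_eq_true,
          Function.update_of_ne, Function.update_self]
        rw [h23, hsmul2, h23 _ _ x, smul_eq_mul, mul_neg]
    map_eq_zero_of_eq' := fun v i j h hij => by
      have e1 : ∀ a c, T a a c = 0 := fun a c => hself _ (h12 a a c)
      have e2 : ∀ a b, T a b b = 0 := fun a b => hself _ (h23 a b b)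
      have e3 : ∀ a b, T a b a = 0 := fun a b => by rw [h23, e1, neg_zero]
      fin_cases i <;> fin_cases j <;> first | exact absurd rfl hij | skip
      all_goals
        simp only [Fin.zero_eta, Fin.mk_one, Fin.reduceFinMk] at h
        simp only [h, e1, e2, e3] }

theorem mkAlternatingThree_apply (T : V → V → V → A) (hadd hsmul h12 h23) (a b c : V) :
    mkAlternatingThree T hadd hsmul h12 h23 ![a, b, c] = T a b c := rfl

end AlternatingThree

section CourantIdentities

variable {n : ℕ} {M : Type*} [TopologicalSpace M] [ChartedSpace (EuclideanSpace ℝ (Fin n)) M]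
  [IsManifold (𝓡 n) ∞ M]
  {F : Type*} [NormedAddCommGroup F] [NormedSpace ℝ F]
  {E : M → Type*} [∀ x, AddCommGroup (E x)] [∀ x, Module ℝ (E x)]
  [∀ x, TopologicalSpace (E x)] [TopologicalSpace (Bundle.TotalSpace F E)]
  [FiberBundle F E] [VectorBundle ℝ F E]

namespace CourantAlgebroid

variable (C : CourantAlgebroid n F E)

theorem pair_bracket_swap (e₁ e₂ g : Sections n F E) :
    C.pair (C.bracket e₁ e₂) g = C.act g (C.pair e₁ e₂) - C.pair (C.bracket e₂ e₁) g := by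
  rw [← C.bracket_symm, C.pair_add_left, add_sub_cancel_right]

theorem pair_bracket_smul_right (f : SmoothFun n M) (e₁ e₂ g : Sections n F E) :
    C.pair (C.bracket e₁ (f • e₂)) g =
      f * C.pair (C.bracket e₁ e₂) g + C.act e₁ f * C.pair e₂ g := by
  have h1 := C.act_pair e₁ (f • e₂) g
  have h2 := C.act_pair e₁ e₂ g
  rw [C.pair_smul_left, C.pair_smul_left, C.act_mul_right, h2] at h1
  linear_combination -h1

theorem pair_bracket_smul_left (f : SmoothFun n M) (e₁ e₂ g : Sections n F E) :
    C.pair (C.bracket (f • e₁) e₂) g =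
      f * C.pair (C.bracket e₁ e₂) g + C.act g f * C.pair e₁ e₂ - C.act e₂ f * C.pair e₁ g := by
  rw [pair_bracket_swap, pair_bracket_smul_right, C.pair_smul_left, C.act_mul_right,
    C.pair_bracket_swap e₁ e₂]
  ring

variable [T2Space M] [ContMDiffVectorBundle ∞ F E (𝓡 n)]

variable (n F) in
/-- Every vector of `E` is the value of a global smooth section. -/
theorem exists_section (x₀ : M) (u : E x₀) : ∃ e : Sections n F E, e x₀ = u := by
  obtain ⟨U, hU, hs⟩ := FiberBundle.exists_contMDiffOn_extend (I := 𝓡 n) (k := ∞) F u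
  obtain ⟨χ, -, hχ⟩ := (SmoothBumpFunction.nhds_basis_tsupport (I := 𝓡 n) x₀).mem_iff.1
    (interior_mem_nhds.2 hU)
  have hsm : ContMDiff (𝓡 n) ((𝓡 n).prod 𝓘(ℝ, F)) ∞
      (fun x => (⟨x, (χ x • FiberBundle.extend F u x)⟩ : Bundle.TotalSpace F E)) :=
    ContMDiffOn.smul_section_of_tsupport (χ.contMDiff.contMDiffOn) isOpen_interior hχ
      (hs.mono interior_subset)
  refine ⟨⟨fun x => χ x • FiberBundle.extend F u x, hsm⟩, ?_⟩
  change χ x₀ • FiberBundle.extend F u x₀ = u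
  rw [χ.eq_one, one_smul, FiberBundle.extend_apply_self]

theorem ext_pair {e e' : Sections n F E} (h : ∀ g, C.pair e g = C.pair e' g) : e = e' := by
  ext x
  rw [← sub_eq_zero]
  refine C.form_nondegenerate x _ fun v => ?_
  obtain ⟨g, rfl⟩ := exists_section n F x v
  rw [map_sub, LinearMap.sub_apply, sub_eq_zero]
  exact congrArg (fun f : SmoothFun n M => f x) (h g)

end CourantAlgebroid

end CourantIdentities

section LieAlgebroid

variable {n : ℕ} {M : Type*} [TopologicalSpace M] [ChartedSpace (EuclideanSpace ℝ (Fin n)) M]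
  [IsManifold (𝓡 n) ∞ M]
  {F : Type*} [NormedAddCommGroup F] [NormedSpace ℝ F]
  {E : M → Type*} [∀ x, AddCommGroup (E x)] [∀ x, Module ℝ (E x)]
  [∀ x, TopologicalSpace (E x)] [TopologicalSpace (Bundle.TotalSpace F E)]
  [FiberBundle F E] [VectorBundle ℝ F E]
  {C : CourantAlgebroid n F E}

namespace DiracStructure

variable (D : DiracStructure C)

/-- The `C^∞(M)`-module `Γ^∞(L)` of sections of the Dirac structure. -/
abbrev Sec : Type _ := sectionsOf n F D.L

/-- The space `Γ^∞(⋀^k L^*)` of `k`-forms on `L`, as `C^∞(M)`-multilinear alternating maps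
`Γ^∞(L) × ⋯ × Γ^∞(L) → C^∞(M)`. -/
abbrev Form (k : ℕ) : Type _ := D.Sec [⋀^Fin k]→ₗ[SmoothFun n M] SmoothFun n M

theorem pair_eq_zero (s t : D.Sec) : C.pair (s : Sections n F E) (t : Sections n F E) = 0 := by
  ext x; exact D.isotropic x _ (s.2 x) _ (t.2 x)

/-- The Lie bracket on `Γ^∞(L)`: the restriction of the Courant bracket. -/
def bracket : D.Sec →ₗ[ℝ] D.Sec →ₗ[ℝ] D.Sec :=
  LinearMap.mk₂ ℝ (fun s t => ⟨C.bracket s t, D.closed s s.2 t t.2⟩)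
    (fun s s' t => Subtype.ext (by simp)) (fun c s t => Subtype.ext (by simp))
    (fun s t t' => Subtype.ext (by simp)) (fun c s t => Subtype.ext (by simp))

theorem coe_bracket (s t : D.Sec) :
    (D.bracket s t : Sections n F E) = C.bracket (s : Sections n F E) (t : Sections n F E) := rfl

/-- The action `s ↦ (f ↦ ρ(s) f)` of `Γ^∞(L)` on functions through the anchor. -/
def act : D.Sec →ₗ[ℝ] SmoothFun n M →ₗ[ℝ] SmoothFun n M :=
  LinearMap.mk₂ ℝ (fun s f => C.act s f)
    (fun s s' f => C.act_add_left _ _ _)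
    (fun c s f => by
      rw [← algebraMap_smul (SmoothFun n M) c s, Submodule.coe_smul, C.act_smul_left,
        Algebra.smul_def])
    (fun s f g => C.act_add_right _ _ _) (fun c s f => C.act_real_smul_right _ _ _)

theorem act_apply (s : D.Sec) (f : SmoothFun n M) :
    D.act s f = C.act (s : Sections n F E) f := rfl

variable {D} in
theorem form_two_swap (η : D.Form 2) (s t : D.Sec) : η ![s, t] = -η ![t, s] := by
  have := η.map_swap ![t, s] (show (0 : Fin 2) ≠ 1 by decide)
  rw [← this]
  congr 1
  funext i; fin_cases i <;> rfl

variable {D} in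
theorem form_two_smul (η : D.Form 2) (f : SmoothFun n M) (s t : D.Sec) :
    η ![s, f • t] = f * η ![s, t] :=
  (η.curryLeft s).toMultilinearMap.cons_smul ![] f t

variable {D} in
theorem form_two_add (η : D.Form 2) (s t t' : D.Sec) :
    η ![s, t + t'] = η ![s, t] + η ![s, t'] :=
  (η.curryLeft s).toMultilinearMap.cons_add ![] t t'

variable [T2Space M] [ContMDiffVectorBundle ∞ F E (𝓡 n)]

theorem bracket_skew (s t : D.Sec) : D.bracket s t = -D.bracket t s := by
  apply Subtype.ext
  apply C.ext_pair
  intro g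
  rw [Submodule.coe_neg, C.pair_neg_left, coe_bracket, coe_bracket, C.pair_bracket_swap,
    D.pair_eq_zero]
  have : C.act g 0 = 0 := by simpa using C.act_real_smul_right g 0 0
  rw [this, zero_sub]

theorem bracket_smul_left (f : SmoothFun n M) (s t : D.Sec) :
    D.bracket (f • s) t = f • D.bracket s t - D.act t f • s := by
  apply Subtype.ext
  apply C.ext_pair
  intro g
  rw [coe_bracket, Submodule.coe_smul, C.pair_bracket_smul_left, D.pair_eq_zero,
    AddSubgroupClass.coe_sub, sub_eq_add_neg (G := Sections n F E), C.pair_add_left, C.pair_neg_left, Submodule.coe_smul, Submodule.coe_smul,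
    C.pair_smul_left, C.pair_smul_left, coe_bracket, act_apply]
  ring

/-- The Lie algebroid differential `d_L : Γ^∞(⋀^{k+1} L^*) → Γ^∞(⋀^{k+2} L^*)`, given by the
Chevalley-Eilenberg formula, see `dL_apply`. -/
def dL (k : ℕ) : D.Form (k + 1) →ₗ[ℝ] D.Form (k + 2) :=
  chevalleyEilenbergLM D.act D.bracket
    (fun f s g => C.act_smul_left f s g) (fun s f g => C.act_mul_right s f g)
    D.bracket_skew D.bracket_smul_left k

theorem dL_apply (k : ℕ) (η : D.Form (k + 1)) (s : Fin (k + 2) → D.Sec) :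
    D.dL k η s =
      (∑ i : Fin (k + 2), (-1 : ℤ) ^ (i : ℕ) • D.act (s i) (η (i.removeNth s))) -
        ∑ i : Fin (k + 1), ∑ j ≥ i, (-1 : ℤ) ^ (i + j : ℕ) •
          η (Matrix.vecCons (D.bracket (s i.castSucc) (s j.succ))
            (j.removeNth (i.castSucc.removeNth s))) :=
  chevalleyEilenbergLM_apply _ _ _ _ _ _ η s

theorem dL_two_apply (η : D.Form 2) (a b c : D.Sec) :
    D.dL 1 η ![a, b, c] =
      D.act a (η ![b, c]) - D.act b (η ![a, c]) + D.act c (η ![a, b]) -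
        η ![D.bracket a b, c] + η ![D.bracket a c, b] - η ![D.bracket b c, a] := by
  have hr : ∀ p : Fin 3, p.removeNth ![a, b, c] = ![![b, c], ![a, c], ![a, b]] p := by
    intro p; funext l; fin_cases p <;> fin_cases l <;> rfl
  have i0 : Finset.Ici (0 : Fin 2) = {0, 1} := rfl
  have i1 : Finset.Ici (1 : Fin 2) = {1} := rfl
  have h2 : ∀ x y : D.Sec, (0 : Fin 2).removeNth ![x, y] = ![y] := by
    intro x y; funext l; fin_cases l; rfl
  have h3 : ∀ x y : D.Sec, (1 : Fin 2).removeNth ![x, y] = ![x] := by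
    intro x y; funext l; fin_cases l; rfl
  rw [dL_apply]
  change (∑ i : Fin 3, (-1 : ℤ) ^ (i : ℕ) • D.act (![a, b, c] i) (η (i.removeNth ![a, b, c]))) -
    ∑ i : Fin 2, ∑ j ∈ Finset.Ici i, (-1 : ℤ) ^ (i + j : ℕ) •
      η (Matrix.vecCons (D.bracket (![a, b, c] i.castSucc) (![a, b, c] j.succ))
        (j.removeNth (i.castSucc.removeNth ![a, b, c]))) = _
  simp only [hr]
  rw [Fin.sum_univ_three, Fin.sum_univ_two, i0, i1, Finset.sum_pair (by decide),
    Finset.sum_singleton]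
  change _ - ((-1 : ℤ) ^ 0 • η (Matrix.vecCons (D.bracket a b) ((0 : Fin 2).removeNth ![b, c])) +
    (-1 : ℤ) ^ 1 • η (Matrix.vecCons (D.bracket a c) ((1 : Fin 2).removeNth ![b, c])) +
    (-1 : ℤ) ^ 2 • η (Matrix.vecCons (D.bracket b c) ((1 : Fin 2).removeNth ![a, c]))) = _
  rw [h2, h3, h3]
  simp
  abel

/-- The `d_L`-closed `(k+2)`-forms. -/
def cocycles (k : ℕ) : Submodule ℝ (D.Form (k + 2)) := LinearMap.ker (D.dL (k + 1))

/-- The `d_L`-exact `(k+2)`-forms. -/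
def coboundaries (k : ℕ) : Submodule ℝ (D.Form (k + 2)) := LinearMap.range (D.dL k)

instance instAddCommGroupCocycles (k : ℕ) : AddCommGroup (D.cocycles k) := inferInstance

/-- The Lie algebroid cohomology `H^{k+2}(L) = ker d_L / im d_L`. -/
abbrev Cohomology (k : ℕ) : Type _ :=
  D.cocycles k ⧸ (D.coboundaries k).submoduleOf (D.cocycles k)

/-- The class in `H^{k+2}(L)` of a `d_L`-closed `(k+2)`-form. -/
def cohomologyClass {k : ℕ} (θ : D.Form (k + 2)) (h : D.dL (k + 1) θ = 0) : D.Cohomology k :=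
  Submodule.Quotient.mk ⟨θ, LinearMap.mem_ker.2 h⟩

end DiracStructure
end LieAlgebroid

section Deformation

variable {n : ℕ} {M : Type*} [TopologicalSpace M] [ChartedSpace (EuclideanSpace ℝ (Fin n)) M]
  [IsManifold (𝓡 n) ∞ M]
  {F : Type*} [NormedAddCommGroup F] [NormedSpace ℝ F]
  {E : M → Type*} [∀ x, AddCommGroup (E x)] [∀ x, Module ℝ (E x)]
  [∀ x, TopologicalSpace (E x)] [TopologicalSpace (Bundle.TotalSpace F E)]
  [FiberBundle F E] [VectorBundle ℝ F E]
  {C : CourantAlgebroid n F E} {D : DiracStructure C}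

namespace IsotropicComplement

variable (S : IsotropicComplement D)

/-- The `C^∞(M)`-module `Γ^∞(L')` of sections of the complement, i.e. `Γ^∞(L^*)`. -/
abbrev Sec : Type _ := sectionsOf n F S.L'

theorem pair_eq_zero (α β : S.Sec) :
    C.pair (α : Sections n F E) (β : Sections n F E) = 0 := by
  ext x; exact S.isotropic x _ (α.2 x) _ (β.2 x)

theorem act_zero (e : Sections n F E) : C.act e 0 = 0 := by
  simpa using C.act_real_smul_right e 0 0

theorem pair_bracket_skew (α β : S.Sec) (g : Sections n F E) :
    C.pair (C.bracket (α : Sections n F E) β) g =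
      -C.pair (C.bracket (β : Sections n F E) α) g := by
  rw [C.pair_bracket_swap, S.pair_eq_zero, act_zero, zero_sub]

/-- The element `ψ ∈ Γ^∞(⋀^3 L)`, `ψ(α,β,γ) = -⟨[α,β],γ⟩` for `α, β, γ ∈ Γ^∞(L')`. -/
def psi : S.Sec [⋀^Fin 3]→ₗ[SmoothFun n M] SmoothFun n M :=
  mkAlternatingThree (fun α β γ => -C.pair (C.bracket (α : Sections n F E) β) γ)
    (fun α α' β γ => by simp [C.pair_add_left, add_comm])
    (fun f α β γ => by
      rw [Submodule.coe_smul, C.pair_bracket_smul_left, S.pair_eq_zero, S.pair_eq_zero]; ring)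
    (fun α β γ => by rw [S.pair_bracket_skew])
    (fun α β γ => by
      have h := C.act_pair (α : Sections n F E) β γ
      rw [S.pair_eq_zero, act_zero, C.pair_comm (β : Sections n F E)] at h
      linear_combination h)

theorem psi_apply (α β γ : S.Sec) :
    S.psi ![α, β, γ] = -C.pair (C.bracket (α : Sections n F E) β) γ := rfl

/-- The wedge product `α₁ ∧ ⋯ ∧ α_k` of one-forms,
`(α₁ ∧ ⋯ ∧ α_k)(s₁,…,s_k) = ∑_π sgn(π) ∏_i α_i(s_{π(i)})`. -/
def wedge {k : ℕ} (α : Fin k → S.Sec) : D.Form k :=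
  MultilinearMap.alternatization
    ((MultilinearMap.mkPiAlgebra (SmoothFun n M) (Fin k) (SmoothFun n M)).compLinearMap
      fun i => (C.pairLM (α i : Sections n F E)).comp (sectionsOf n F D.L).subtype)

theorem wedge_apply {k : ℕ} (α : Fin k → S.Sec) (s : Fin k → D.Sec) :
    S.wedge α s = (Matrix.of fun i j => C.pair (α j : Sections n F E) (s i)).det := by
  rw [wedge, MultilinearMap.alternatization_apply, Matrix.det_apply]
  rfl

theorem wedge_two (α β : S.Sec) (a b : D.Sec) :
    S.wedge ![α, β] ![a, b] =
      C.pair (α : Sections n F E) a * C.pair (β : Sections n F E) b -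
        C.pair (β : Sections n F E) a * C.pair (α : Sections n F E) b := by
  rw [wedge_apply, Matrix.det_fin_two]; rfl

theorem wedge_three (α β γ : S.Sec) (a b c : D.Sec) :
    S.wedge ![α, β, γ] ![a, b, c] =
      C.pair (α : Sections n F E) a * C.pair (β : Sections n F E) b *
        C.pair (γ : Sections n F E) c -
      C.pair (α : Sections n F E) a * C.pair (γ : Sections n F E) b *
        C.pair (β : Sections n F E) c -
      C.pair (β : Sections n F E) a * C.pair (α : Sections n F E) b *
        C.pair (γ : Sections n F E) c +
      C.pair (β : Sections n F E) a * C.pair (γ : Sections n F E) b *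
        C.pair (α : Sections n F E) c +
      C.pair (γ : Sections n F E) a * C.pair (α : Sections n F E) b *
        C.pair (β : Sections n F E) c -
      C.pair (γ : Sections n F E) a * C.pair (β : Sections n F E) b *
        C.pair (α : Sections n F E) c := by
  rw [wedge_apply, Matrix.det_fin_three]
  simp only [Matrix.of_apply, Matrix.cons_val_zero, Matrix.cons_val_one, Matrix.cons_val]

variable [T2Space M]

/-- The bracket `[α,β]_* = pr_{L'} [α,β]` on `Γ^∞(L') ≅ Γ^∞(L^*)`: as an element of `Γ^∞(L^*)`
it is the functional `s ↦ ⟨[α,β],s⟩`. -/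
def dualBracket (α β : S.Sec) : S.Sec :=
  S.ofDual ((C.pairLM (C.bracket (α : Sections n F E) β)).comp (sectionsOf n F D.L).subtype)

theorem pair_dualBracket (α β : S.Sec) (s : D.Sec) :
    C.pair (S.dualBracket α β : Sections n F E) s =
      C.pair (C.bracket (α : Sections n F E) β) s :=
  S.pair_ofDual _ s

/-- `[α,β]_*` is the component of `[α,β]` in `L'` with respect to `E = L ⊕ L'`. -/
theorem bracket_sub_dualBracket_mem (α β : S.Sec) :
    C.bracket (α : Sections n F E) β - S.dualBracket α β ∈ sectionsOf n F D.L := by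
  intro x
  obtain ⟨r, t, ht⟩ := D.subbundle.exists_frame x
  obtain ⟨u, hu, v, hv, huv⟩ := Submodule.mem_sup.1
    ((S.isCompl x).sup_eq_top ▸ (Submodule.mem_top :
      (C.bracket (α : Sections n F E) β - S.dualBracket α β : Sections n F E) x ∈ ⊤))
  have hv0 : v = 0 := by
    apply S.form_zero_right hv
    intro w hw
    rw [← ht.self_of_nhds.2] at hw
    induction hw using Submodule.span_induction with
    | mem w hw =>
      obtain ⟨i, rfl⟩ := hw
      have h1 : C.pair (C.bracket (α : Sections n F E) β - S.dualBracket α β) (t i) = 0 := by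
        rw [sub_eq_add_neg, C.pair_add_left, C.pair_neg_left, S.pair_dualBracket,
          add_neg_cancel]
      have h2 : C.form x ((C.bracket (α : Sections n F E) β - S.dualBracket α β :
          Sections n F E) x) ((t i : Sections n F E) x) = 0 :=
        congrArg (fun f : SmoothFun n M => f x) h1
      rw [← huv, map_add, LinearMap.add_apply, D.isotropic x u hu _ ((t i).2 x), zero_add] at h2
      rw [C.form_symm, h2]
    | zero => simp
    | add a b _ _ ha hb => rw [map_add, LinearMap.add_apply, ha, hb, add_zero]
    | smul c a _ ha => rw [map_smul, LinearMap.smul_apply, ha, smul_zero]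
  rw [← huv, hv0, add_zero]
  exact hu

/-- A two-form `η` on `L` as a map `L → L^* ≅ L'`, with `η(s)(t) = η(s,t)`. -/
def sharp (η : D.Form 2) : D.Sec →ₗ[SmoothFun n M] S.Sec :=
  S.ofDual ∘ₗ LinearMap.mk₂ (SmoothFun n M) (fun s t => η ![s, t])
    (fun s s' t => η.toMultilinearMap.cons_add ![t] s s')
    (fun f s t => η.toMultilinearMap.cons_smul ![t] f s)
    (fun s t t' => (η.curryLeft s).toMultilinearMap.cons_add ![] t t')
    (fun f s t => (η.curryLeft s).toMultilinearMap.cons_smul ![] f t)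

theorem pair_sharp (η : D.Form 2) (s t : D.Sec) :
    C.pair (S.sharp η s : Sections n F E) t = η ![s, t] :=
  S.pair_ofDual _ t

/-- The summand of `schouten` whose cyclic sum gives the bracket. -/
def schoutenTerm (η μ : D.Form 2) (a b c : D.Sec) : SmoothFun n M :=
  C.pair (S.dualBracket (S.sharp η a) (S.sharp μ b)) c -
    C.pair (S.dualBracket (S.sharp η b) (S.sharp μ a)) c -
    C.act (S.sharp η a) (μ ![b, c]) - C.act (S.sharp μ a) (η ![b, c])

/-- The bracket `[η,μ]_* ∈ Γ^∞(⋀^3 L^*)` of two-forms, i.e. the extension of `[·,·]_*` from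
`Γ^∞(L^*)` to `Γ^∞(⋀^• L^*)` by the graded Leibniz rule with `[α,f]_* = ρ(α) f`. It is the
biadditive map with
`[α₁ ∧ α₂, β₁ ∧ β₂]_* = ∑_{i,j} (-1)^{i+j} [α_i,β_j]_* ∧ α_{3-i} ∧ β_{3-j}`, see
`schouten_wedge`; the formula used here evaluates it on all two-forms:
`[η,μ]_*(a,b,c) = ∑_{cyclic} (⟨[η(a),μ(b)]_*,c⟩ - ⟨[η(b),μ(a)]_*,c⟩ - ρ(η(a)) μ(b,c) -
ρ(μ(a)) η(b,c))`. -/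
def schouten (η μ : D.Form 2) : D.Form 3 :=
  mkAlternatingThree
    (fun a b c => S.schoutenTerm η μ a b c + S.schoutenTerm η μ b c a + S.schoutenTerm η μ c a b)
    (fun a a' b c => by
      have h1 : ∀ (θ : D.Form 2) (t : D.Sec), θ ![a + a', t] = θ ![a, t] + θ ![a', t] :=
        fun θ t => θ.toMultilinearMap.cons_add ![t] a a'
      simp only [schoutenTerm, pair_dualBracket, map_add, Submodule.coe_add, C.pair_add_left,
        C.pair_add_right, C.act_add_left, C.act_add_right, LinearMap.add_apply, DiracStructure.form_two_add, h1]
      ring)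
    (fun f a b c => by
      have h1 : ∀ (θ : D.Form 2) (t : D.Sec), θ ![f • a, t] = f * θ ![a, t] :=
        fun θ t => θ.toMultilinearMap.cons_smul ![t] f a
      simp only [schoutenTerm, pair_dualBracket, map_smul, Submodule.coe_smul,
        C.pair_smul_right, C.act_smul_left, DiracStructure.form_two_smul, h1,
        C.pair_bracket_smul_left, C.pair_bracket_smul_right, S.pair_eq_zero, pair_sharp,
        C.act_mul_right]
      rw [DiracStructure.form_two_swap η c a, DiracStructure.form_two_swap μ c a]
      ring)
    (fun a b c => by
      simp only [schoutenTerm]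
      rw [DiracStructure.form_two_swap η c a, DiracStructure.form_two_swap μ c a, DiracStructure.form_two_swap η b c, DiracStructure.form_two_swap μ b c,
        DiracStructure.form_two_swap η a b, DiracStructure.form_two_swap μ a b]
      simp only [C.act_neg_right]
      ring)
    (fun a b c => by
      simp only [schoutenTerm]
      rw [DiracStructure.form_two_swap η c a, DiracStructure.form_two_swap μ c a, DiracStructure.form_two_swap η b c, DiracStructure.form_two_swap μ b c,
        DiracStructure.form_two_swap η a b, DiracStructure.form_two_swap μ a b]
      simp only [C.act_neg_right]
      ring)

theorem schouten_apply (η μ : D.Form 2) (a b c : D.Sec) :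
    S.schouten η μ ![a, b, c] =
      S.schoutenTerm η μ a b c + S.schoutenTerm η μ b c a + S.schoutenTerm η μ c a b := rfl

/-- The ternary bracket of two-forms defined by `ψ`,
`[η,μ,ν]_ψ(s₁,s₂,s₃) = -∑_π sgn(π) ψ(η(s_{π(1)}), μ(s_{π(2)}), ν(s_{π(3)}))`. -/
def ternary (η μ ν : D.Form 2) : D.Form 3 :=
  -MultilinearMap.alternatization
    (S.psi.toMultilinearMap.compLinearMap ![S.sharp η, S.sharp μ, S.sharp ν])

theorem ternary_self_apply (η : D.Form 2) (a b c : D.Sec) :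
    S.ternary η η η ![a, b, c] =
      (6 : ℝ) • C.pair (C.bracket (S.sharp η a : Sections n F E) (S.sharp η b)) (S.sharp η c) := by
  have h : ∀ σ : Equiv.Perm (Fin 3),
      (S.psi.toMultilinearMap.compLinearMap ![S.sharp η, S.sharp η, S.sharp η])
        (fun i => ![a, b, c] (σ i)) =
      Equiv.Perm.sign σ • S.psi ![S.sharp η a, S.sharp η b, S.sharp η c] := by
    intro σ
    rw [← S.psi.map_perm, MultilinearMap.compLinearMap_apply]
    change S.psi _ = _
    congr 1
    funext i
    have : ∀ j : Fin 3, ![S.sharp η a, S.sharp η b, S.sharp η c] j = S.sharp η (![a, b, c] j) := by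
      intro j; fin_cases j <;> rfl
    rw [Function.comp_apply, this]
    have : ∀ j : Fin 3, ![S.sharp η, S.sharp η, S.sharp η] j = S.sharp η := by
      intro j; fin_cases j <;> rfl
    rw [this]
  rw [ternary, AlternatingMap.neg_apply, MultilinearMap.alternatization_apply]
  simp only [MultilinearMap.domDomCongr_apply, h, smul_smul, Int.units_mul_self, one_smul,
    Finset.sum_const, Finset.card_univ, Fintype.card_perm, Fintype.card_fin, psi_apply]
  rw [smul_neg, neg_neg, ← Nat.cast_smul_eq_nsmul ℝ]
  norm_num [Nat.factorial]

theorem sharp_wedge (α β : S.Sec) (a : D.Sec) :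
    S.sharp (S.wedge ![α, β]) a =
      C.pair (α : Sections n F E) a • β + (-C.pair (β : Sections n F E) a) • α := by
  apply S.rep_unique
  intro s
  rw [pair_sharp, wedge_two, Submodule.coe_add, C.pair_add_left, Submodule.coe_smul,
    Submodule.coe_smul, C.pair_smul_left, C.pair_smul_left]
  ring

/-- The bracket `[·,·]_*` on decomposable two-forms, as required by the Leibniz rule. -/
theorem schouten_wedge (α₁ α₂ β₁ β₂ : S.Sec) :
    S.schouten (S.wedge ![α₁, α₂]) (S.wedge ![β₁, β₂]) =
      S.wedge ![S.dualBracket α₁ β₁, α₂, β₂] - S.wedge ![S.dualBracket α₁ β₂, α₂, β₁] -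
        S.wedge ![S.dualBracket α₂ β₁, α₁, β₂] + S.wedge ![S.dualBracket α₂ β₂, α₁, β₁] := by
  have hv : ∀ v : Fin 3 → D.Sec, v = ![v 0, v 1, v 2] := by
    intro v; funext i; fin_cases i <;> rfl
  ext1 v
  rw [hv v]
  generalize v 0 = a, v 1 = b, v 2 = c
  simp only [AlternatingMap.add_apply, AlternatingMap.neg_apply, wedge_three, schouten_apply,
    schoutenTerm, pair_dualBracket, sharp_wedge, wedge_two, Submodule.coe_add,
    Submodule.coe_smul, map_add, LinearMap.add_apply, C.pair_add_left, C.act_add_left,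
    C.act_smul_left, C.pair_bracket_smul_left, C.pair_bracket_smul_right, sub_eq_add_neg,
    C.act_add_right, C.act_neg_right, C.act_mul_right, C.pair_smul_right, S.pair_eq_zero]
  ring

theorem schouten_comm (η μ : D.Form 2) : S.schouten η μ = S.schouten μ η := by
  ext1 v
  change S.schoutenTerm η μ _ _ _ + S.schoutenTerm η μ _ _ _ + S.schoutenTerm η μ _ _ _ =
    S.schoutenTerm μ η _ _ _ + S.schoutenTerm μ η _ _ _ + S.schoutenTerm μ η _ _ _
  simp only [schoutenTerm, pair_dualBracket]
  rw [S.pair_bracket_skew (S.sharp η (v 0)), S.pair_bracket_skew (S.sharp η (v 0)),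
    S.pair_bracket_skew (S.sharp η (v 1)), S.pair_bracket_skew (S.sharp η (v 1)),
    S.pair_bracket_skew (S.sharp η (v 2)), S.pair_bracket_skew (S.sharp η (v 2))]
  ring

theorem schouten_add_left (η η' μ : D.Form 2) :
    S.schouten (η + η') μ = S.schouten η μ + S.schouten η' μ := by
  have hs : ∀ a, S.sharp (η + η') a = S.sharp η a + S.sharp η' a := fun a => by
    apply S.rep_unique
    intro t
    rw [Submodule.coe_add, C.pair_add_left]
    simp only [pair_sharp]; rfl
  ext1 v
  change S.schoutenTerm (η + η') μ _ _ _ + S.schoutenTerm (η + η') μ _ _ _ +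
      S.schoutenTerm (η + η') μ _ _ _ =
    S.schoutenTerm η μ _ _ _ + S.schoutenTerm η μ _ _ _ + S.schoutenTerm η μ _ _ _ +
    (S.schoutenTerm η' μ _ _ _ + S.schoutenTerm η' μ _ _ _ + S.schoutenTerm η' μ _ _ _)
  simp only [schoutenTerm, pair_dualBracket, hs, AlternatingMap.add_apply, Submodule.coe_add,
    map_add, LinearMap.add_apply, C.pair_add_left, C.act_add_left, C.act_add_right]
  ring

/-- The left hand side of the deformation equation for `η`, evaluated on `a, b, c`, is
`⟨[a + η(a), b + η(b)], c + η(c)⟩`: it vanishes if and only if the graph of `η` is closed under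
the Courant bracket. -/
theorem graph_apply [ContMDiffVectorBundle ∞ F E (𝓡 n)] (η : D.Form 2) (a b c : D.Sec) :
    D.dL 1 η ![a, b, c] + (1 / 2 : ℝ) • S.schouten η η ![a, b, c] +
        (1 / 6 : ℝ) • S.ternary η η η ![a, b, c] =
      C.pair (C.bracket ((a : Sections n F E) + S.sharp η a) ((b : Sections n F E) + S.sharp η b))
        ((c : Sections n F E) + S.sharp η c) := by
  have h6 : (1 / 6 : ℝ) • S.ternary η η η ![a, b, c] =
      C.pair (C.bracket (S.sharp η a : Sections n F E) (S.sharp η b)) (S.sharp η c) := by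
    rw [ternary_self_apply, smul_smul]; norm_num
  have h2 : (1 / 2 : ℝ) • S.schouten η η ![a, b, c] =
      C.pair (C.bracket (S.sharp η a : Sections n F E) (S.sharp η b)) c +
      C.pair (C.bracket (S.sharp η b : Sections n F E) (S.sharp η c)) a +
      C.pair (C.bracket (S.sharp η c : Sections n F E) (S.sharp η a)) b -
      C.act (S.sharp η a) (η ![b, c]) - C.act (S.sharp η b) (η ![c, a]) -
      C.act (S.sharp η c) (η ![a, b]) := by
    have hhalf : ∀ x y : SmoothFun n M, x = y + y → (1 / 2 : ℝ) • x = y := by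
      rintro x y rfl
      rw [← two_smul ℝ, smul_smul]; norm_num
    apply hhalf
    rw [schouten_apply]
    simp only [schoutenTerm, pair_dualBracket]
    rw [S.pair_bracket_skew (S.sharp η b) (S.sharp η a),
      S.pair_bracket_skew (S.sharp η c) (S.sharp η b),
      S.pair_bracket_skew (S.sharp η a) (S.sharp η c)]
    ring
  have hs : ∀ s t : D.Sec, C.pair (t : Sections n F E) (S.sharp η s) = η ![s, t] := fun s t => by
    rw [C.pair_comm, pair_sharp]
  have h0 := D.pair_eq_zero (D.bracket a b) c
  rw [D.coe_bracket] at h0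
  have k1 : C.pair (C.bracket (a : Sections n F E) b) (S.sharp η c) = -η ![D.bracket a b, c] := by
    rw [← DiracStructure.form_two_swap, ← hs, D.coe_bracket]
  have k2 : C.pair (C.bracket (a : Sections n F E) (S.sharp η b)) c =
      C.act a (η ![b, c]) + η ![D.bracket a c, b] := by
    have := C.act_pair a (S.sharp η b) c
    rw [pair_sharp, ← D.coe_bracket, pair_sharp, DiracStructure.form_two_swap η b (D.bracket _ _)]
      at this
    linear_combination -this
  have k3 : C.pair (C.bracket (S.sharp η a : Sections n F E) b) c =
      C.act c (η ![a, b]) - C.act b (η ![a, c]) - η ![D.bracket b c, a] := by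
    have := C.act_pair b (S.sharp η a) c
    rw [pair_sharp, ← D.coe_bracket, pair_sharp, DiracStructure.form_two_swap η a (D.bracket _ _)]
      at this
    rw [C.pair_bracket_swap, pair_sharp]
    linear_combination this
  have q1 : C.pair (C.bracket (S.sharp η a : Sections n F E) b) (S.sharp η c) =
      -C.act (S.sharp η a) (η ![b, c]) +
        C.pair (C.bracket (S.sharp η c : Sections n F E) (S.sharp η a)) b := by
    have := C.act_pair (S.sharp η a) b (S.sharp η c)
    rw [hs, C.pair_comm b, S.pair_bracket_skew, DiracStructure.form_two_swap, C.act_neg_right] at this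
    linear_combination -this
  have q2 : C.pair (C.bracket (a : Sections n F E) (S.sharp η b)) (S.sharp η c) =
      -C.act (S.sharp η c) (η ![a, b]) - C.act (S.sharp η b) (η ![c, a]) +
        C.pair (C.bracket (S.sharp η b : Sections n F E) (S.sharp η c)) a := by
    have := C.act_pair (S.sharp η b) a (S.sharp η c)
    rw [hs, C.pair_comm a] at this
    rw [C.pair_bracket_swap, hs, DiracStructure.form_two_swap, C.act_neg_right]
    linear_combination this
  rw [h6, h2, D.dL_two_apply]
  simp only [map_add, LinearMap.add_apply, C.pair_add_left, C.pair_add_right, h0, k1, k2, k3, q1,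
    q2, D.act_apply]
  ring
/-- The coefficient of `t^m` in `d_L w_t + ½ [w_t,w_t]_* + ⅙ [w_t,w_t,w_t]_ψ`, where
`w_t = ∑ t^i w_i`. -/
def deformationCoeff [ContMDiffVectorBundle ∞ F E (𝓡 n)] (w : ℕ → D.Form 2) (m : ℕ) : D.Form 3 :=
  D.dL 1 (w m) +
    (1 / 2 : ℝ) • ∑ p ∈ Finset.HasAntidiagonal.antidiagonal m, S.schouten (w p.1) (w p.2) +
    (1 / 6 : ℝ) • ∑ p ∈ Finset.HasAntidiagonal.antidiagonal m, ∑ q ∈ Finset.HasAntidiagonal.antidiagonal p.2,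
      S.ternary (w p.1) (w q.1) (w q.2)


/-- The sequence `w_1, w_2, …` is a formal deformation `w_t = ∑_{i ≥ 1} t^i w_i` of the Dirac
structure of order `N`: the equation
`d_L w_t + ½ [w_t,w_t]_* + ⅙ [w_t,w_t,w_t]_ψ = 0` holds up to order `N` in `t`. -/
def IsFormalDeformation [ContMDiffVectorBundle ∞ F E (𝓡 n)] (N : ℕ) (w : ℕ → D.Form 2) : Prop :=
  w 0 = 0 ∧ ∀ m ≤ N, S.deformationCoeff w m = 0

/-- The element `R_{N+1} = -½ ∑_{i=1}^N [w_i,w_{N+1-i}]_* - ⅙ ∑_{i+j+k=N+1} [w_i,w_j,w_k]_ψ`, where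
the indices `i, j, k` of the second sum run from `1` to `N`. -/
def obstruction (N : ℕ) (w : ℕ → D.Form 2) : D.Form 3 :=
  -((1 / 2 : ℝ) • ∑ i ∈ Finset.Icc 1 N, S.schouten (w i) (w (N + 1 - i))) -
    (1 / 6 : ℝ) • ∑ i ∈ Finset.Icc 1 N, ∑ j ∈ Finset.Icc 1 N, ∑ k ∈ Finset.Icc 1 N,
      if i + j + k = N + 1 then S.ternary (w i) (w j) (w k) else 0

/-- The deformation `w_t` of order `N` extends to order `N + 1`: there is a formal deformation of
order `N + 1` with the same coefficients `w_1, …, w_N`. -/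
def Extends [ContMDiffVectorBundle ∞ F E (𝓡 n)] (N : ℕ) (w : ℕ → D.Form 2) : Prop :=
  ∃ w' : ℕ → D.Form 2, (∀ i ≤ N, w' i = w i) ∧ S.IsFormalDeformation (N + 1) w'

end IsotropicComplement
end Deformation

end

end CourantDeformation

/-!
A two-form `η` on the Dirac structure `L` has the graph `{a + η(a)}`, and by `graph_apply` the left
hand side of the deformation equation is the three-form
`T_η(a, b, c) = ⟨[a + η(a), b + η(b)], c + η(c)⟩`, the curvature of the graph.

The closedness of the obstruction rests on a Bianchi identity for `T_η`, see
`graphDifferential_curvature`. Let `d_η` be the Chevalley-Eilenberg formula in which the anchor is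
`a ↦ ρ(a + η(a))` and the bracket is `(a, b) ↦ pr_L [a + η(a), b + η(b)]`. Then `d_η T_η = 0`
for every `η`: since the graph and `L'` are complementary isotropic subbundles, this is the Jacobi
identity of the Courant bracket for three sections of the graph, paired with a fourth one.
For `η = 0` the formula `d_η` is `d_L`.

For a formal deformation of order `N`, truncated after `t^N`, insert `η = ω_t` with a real number
`t`. By multilinearity `T_{ω_t}` is the polynomial in `t` whose coefficients are those of the
deformation equation (`deformation_sum`), hence `T_{ω_t} = t^{N+1} Q_t` with `Q_0 = -R_{N+1}`.
The Bianchi identity gives `d_{ω_t} Q_t = 0` for `t ≠ 0`. The left hand side is polynomial in `t`, so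
it also vanishes for `t = 0`, which says `d_L R_{N+1} = 0` (`dL_deformationCoeff`,
`dL_obstruction`).

As the series has no constant term, the coefficient of `t^{N+1}` in the deformation equation is
`d_L ω_{N+1} - R_{N+1}` (`deformationCoeff_succ`), so that an extension to order `N + 1` is the same
as a primitive `ω_{N+1}` of `R_{N+1}`.
-/

namespace CourantDeformation

noncomputable section

/-! ### Polynomial curves in real vector spaces -/

section PolynomialCurves

variable {U V W : Type*} [AddCommGroup U] [Module ℝ U] [AddCommGroup V] [Module ℝ V]
  [AddCommGroup W] [Module ℝ W]

/-- A curve `t ↦ ∑ t^k v_k` in a real vector space, with finitely many coefficients `v_k`.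
No topology on the vector space is involved. -/
inductive IsPolynomialCurve : (ℝ → V) → Prop
  | monomial (k : ℕ) (v : V) : IsPolynomialCurve fun t => t ^ k • v
  | add {f g : ℝ → V} (hf : IsPolynomialCurve f) (hg : IsPolynomialCurve g) :
      IsPolynomialCurve fun t => f t + g t

namespace IsPolynomialCurve

theorem const (v : V) : IsPolynomialCurve fun _ : ℝ => v := by
  simpa using monomial 0 v

theorem map (φ : V →ₗ[ℝ] W) {f : ℝ → V} (hf : IsPolynomialCurve f) :
    IsPolynomialCurve fun t => φ (f t) := by
  induction hf with
  | monomial k v => simpa using monomial k (φ v)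
  | add _ _ hf hg => simpa using hf.add hg

theorem map₂ (φ : U →ₗ[ℝ] V →ₗ[ℝ] W) {f : ℝ → U} {g : ℝ → V} (hf : IsPolynomialCurve f)
    (hg : IsPolynomialCurve g) : IsPolynomialCurve fun t => φ (f t) (g t) := by
  induction hf with
  | monomial k u =>
    induction hg with
    | monomial l v => simpa [smul_smul, ← pow_add, add_comm] using monomial (k + l) (φ u v)
    | add _ _ hf hg => simpa using hf.add hg
  | add _ _ hf hg => simpa using hf.add hg

theorem sub {f g : ℝ → V} (hf : IsPolynomialCurve f) (hg : IsPolynomialCurve g) :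
    IsPolynomialCurve fun t => f t - g t := by
  simpa [sub_eq_add_neg] using hf.add (hg.map (-LinearMap.id))

theorem sum {ι : Type*} (s : Finset ι) {f : ι → ℝ → V} (hf : ∀ i, IsPolynomialCurve (f i)) :
    IsPolynomialCurve fun t => ∑ i ∈ s, f i t := by
  classical
  induction s using Finset.induction_on with
  | empty => simpa using const (0 : V)
  | insert a s ha ih => simpa [Finset.sum_insert ha] using (hf a).add ih

theorem continuous {f : ℝ → ℝ} (hf : IsPolynomialCurve f) : Continuous f := by
  induction hf with
  | monomial k v => fun_prop
  | add _ _ hf hg => exact hf.add hg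

end IsPolynomialCurve

/-- Regrouping of a double sum by the total degree. -/
theorem sum_pow_smul_antidiagonal (f : ℕ → ℕ → V) (K L : ℕ) (hK : ∀ i j, K ≤ i → f i j = 0)
    (hL : ∀ i j, L ≤ j → f i j = 0) (t : ℝ) :
    ∑ i ∈ Finset.range K, ∑ j ∈ Finset.range L, t ^ (i + j) • f i j =
      ∑ m ∈ Finset.range (K + L), t ^ m •
        ∑ p ∈ Finset.HasAntidiagonal.antidiagonal m, f p.1 p.2 := by
  rw [← Finset.sum_product', ← Finset.sum_fiberwise_of_maps_to (t := Finset.range (K + L))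
    (g := fun p => p.1 + p.2) (fun p hp => by
      rw [Finset.mem_product, Finset.mem_range, Finset.mem_range] at hp
      rw [Finset.mem_range]
      omega)]
  refine Finset.sum_congr rfl fun m _ => ?_
  rw [Finset.smul_sum]
  refine (Finset.sum_subset (fun p hp => ?_) fun p hp hp' => ?_).trans
    (Finset.sum_congr rfl fun p hp => ?_)
  · exact Finset.HasAntidiagonal.mem_antidiagonal.2 (Finset.mem_filter.1 hp).2
  · rw [Finset.HasAntidiagonal.mem_antidiagonal] at hp
    simp only [Finset.mem_filter, Finset.mem_product, Finset.mem_range, hp, and_true,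
      not_and_or, not_lt] at hp'
    rcases hp' with h | h
    · rw [hK _ _ h, smul_zero]
    · rw [hL _ _ h, smul_zero]
  · rw [Finset.HasAntidiagonal.mem_antidiagonal.1 hp]

/-- The Cauchy product of two polynomial curves under a bilinear map. -/
theorem bilinear_sum_pow_smul (φ : U →ₗ[ℝ] V →ₗ[ℝ] W) (f : ℕ → U) (g : ℕ → V) (K L : ℕ)
    (hf : ∀ i, K ≤ i → f i = 0) (hg : ∀ j, L ≤ j → g j = 0) (t : ℝ) :
    φ (∑ i ∈ Finset.range K, t ^ i • f i) (∑ j ∈ Finset.range L, t ^ j • g j) =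
      ∑ m ∈ Finset.range (K + L), t ^ m •
        ∑ p ∈ Finset.HasAntidiagonal.antidiagonal m, φ (f p.1) (g p.2) := by
  rw [← sum_pow_smul_antidiagonal (fun i j => φ (f i) (g j)) K L
    (fun i j h => by rw [hf i h, map_zero, LinearMap.zero_apply])
    (fun i j h => by rw [hg j h, map_zero])]
  rw [LinearMap.map_sum₂]
  refine Finset.sum_congr rfl fun i _ => ?_
  rw [map_sum]
  refine Finset.sum_congr rfl fun j _ => ?_
  rw [map_smul, map_smul, LinearMap.smul_apply, smul_smul, pow_add, mul_comm]

/-- A polynomial curve of smooth functions that vanishes for `t ≠ 0` also vanishes at `t = 0`. -/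
theorem IsPolynomialCurve.apply_zero_eq_zero {n : ℕ} {M : Type*} [TopologicalSpace M]
    [ChartedSpace (EuclideanSpace ℝ (Fin n)) M] {f : ℝ → SmoothFun n M}
    (hf : IsPolynomialCurve f) (h : ∀ t, t ≠ 0 → f t = 0) : f 0 = 0 := by
  ext x
  have hc : Continuous fun t => f t x :=
    (hf.map ({ toFun := fun g => g x, map_add' := fun _ _ => rfl, map_smul' := fun _ _ => rfl } :
      SmoothFun n M →ₗ[ℝ] ℝ)).continuous
  have h0 : (fun t => f t x) = fun _ => 0 :=
    hc.ext_on (dense_compl_singleton (0 : ℝ)) continuous_const fun t ht =>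
      congrArg (fun g : SmoothFun n M => g x) (h t ht)
  exact congrFun h0 0

end PolynomialCurves

/-! ### Real linearity of the anchor and of the pairing -/

section RealLinearity

variable {n : ℕ} {M : Type*} [TopologicalSpace M] [ChartedSpace (EuclideanSpace ℝ (Fin n)) M]
  [IsManifold (𝓡 n) ∞ M]
  {F : Type*} [NormedAddCommGroup F] [NormedSpace ℝ F]
  {E : M → Type*} [∀ x, AddCommGroup (E x)] [∀ x, Module ℝ (E x)]
  [∀ x, TopologicalSpace (E x)] [TopologicalSpace (Bundle.TotalSpace F E)]
  [FiberBundle F E] [VectorBundle ℝ F E]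

namespace AnchoredMetric

variable (B : AnchoredMetric n F E)

theorem act_real_smul_left (r : ℝ) (e : Sections n F E) (f : SmoothFun n M) :
    B.act (r • e) f = r • B.act e f := by
  rw [← algebraMap_smul (SmoothFun n M) r e, B.act_smul_left, Algebra.smul_def]

/-- The derivative `ρ(e) f` as a real bilinear map. -/
def actLM : Sections n F E →ₗ[ℝ] SmoothFun n M →ₗ[ℝ] SmoothFun n M :=
  LinearMap.mk₂ ℝ B.act B.act_add_left B.act_real_smul_left B.act_add_right
    fun r e f => B.act_real_smul_right e r f

theorem pair_sub_left (e e' g : Sections n F E) : B.pair (e - e') g = B.pair e g - B.pair e' g := by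
  rw [sub_eq_add_neg, B.pair_add_left, B.pair_neg_left, sub_eq_add_neg]

theorem pair_real_smul_left (r : ℝ) (e g : Sections n F E) :
    B.pair (r • e) g = r • B.pair e g := by
  rw [← algebraMap_smul (SmoothFun n M) r e, B.pair_smul_left, Algebra.smul_def]

theorem pair_real_smul_right (r : ℝ) (e g : Sections n F E) :
    B.pair e (r • g) = r • B.pair e g := by
  rw [B.pair_comm, pair_real_smul_left, B.pair_comm]

end AnchoredMetric

end RealLinearity

/-! ### Symmetries and differential of three-forms -/

section Graph

variable {n : ℕ} {M : Type*} [TopologicalSpace M] [ChartedSpace (EuclideanSpace ℝ (Fin n)) M]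
  [IsManifold (𝓡 n) ∞ M]
  {F : Type*} [NormedAddCommGroup F] [NormedSpace ℝ F]
  {E : M → Type*} [∀ x, AddCommGroup (E x)] [∀ x, Module ℝ (E x)]
  [∀ x, TopologicalSpace (E x)] [TopologicalSpace (Bundle.TotalSpace F E)]
  [FiberBundle F E] [VectorBundle ℝ F E]
  {C : CourantAlgebroid n F E} {D : DiracStructure C}

namespace DiracStructure

theorem form_three_swap (θ : D.Form 3) (a b c : D.Sec) : θ ![a, b, c] = -θ ![b, a, c] := by
  have := θ.map_swap ![b, a, c] (show (0 : Fin 3) ≠ 1 by decide)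
  rw [← this]
  congr 1
  funext i; fin_cases i <;> rfl

theorem form_three_swap' (θ : D.Form 3) (a b c : D.Sec) : θ ![a, b, c] = -θ ![a, c, b] := by
  have := θ.map_swap ![a, c, b] (show (1 : Fin 3) ≠ 2 by decide)
  rw [← this]
  congr 1
  funext i; fin_cases i <;> rfl

theorem form_three_ext {θ θ' : D.Form 3} (h : ∀ a b c, θ ![a, b, c] = θ' ![a, b, c]) :
    θ = θ' := by
  ext1 v
  have hv : v = ![v 0, v 1, v 2] := by funext i; fin_cases i <;> rfl
  rw [hv]
  exact h _ _ _

variable [T2Space M] [ContMDiffVectorBundle ∞ F E (𝓡 n)] (D)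

theorem dL_three_apply (θ : D.Form 3) (a b c d : D.Sec) :
    D.dL 2 θ ![a, b, c, d] =
      D.act a (θ ![b, c, d]) - D.act b (θ ![a, c, d]) + D.act c (θ ![a, b, d]) -
        D.act d (θ ![a, b, c]) - θ ![D.bracket a b, c, d] + θ ![D.bracket a c, b, d] -
        θ ![D.bracket a d, b, c] - θ ![D.bracket b c, a, d] + θ ![D.bracket b d, a, c] -
        θ ![D.bracket c d, a, b] := by
  have hr : ∀ p : Fin 4, p.removeNth ![a, b, c, d] =
      ![![b, c, d], ![a, c, d], ![a, b, d], ![a, b, c]] p := by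
    intro p; funext l; fin_cases p <;> fin_cases l <;> rfl
  have hr' : ∀ (x y z : D.Sec) (p : Fin 3), p.removeNth ![x, y, z] =
      ![![y, z], ![x, z], ![x, y]] p := by
    intro x y z p; funext l; fin_cases p <;> fin_cases l <;> rfl
  have i0 : Finset.Ici (0 : Fin 3) = {0, 1, 2} := rfl
  have i1 : Finset.Ici (1 : Fin 3) = {1, 2} := rfl
  have i2 : Finset.Ici (2 : Fin 3) = {2} := rfl
  rw [dL_apply]
  change (∑ i : Fin 4, (-1 : ℤ) ^ (i : ℕ) •
      D.act (![a, b, c, d] i) (θ (i.removeNth ![a, b, c, d]))) -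
    ∑ i : Fin 3, ∑ j ∈ Finset.Ici i, (-1 : ℤ) ^ (i + j : ℕ) •
      θ (Matrix.vecCons (D.bracket (![a, b, c, d] i.castSucc) (![a, b, c, d] j.succ))
        (j.removeNth (i.castSucc.removeNth ![a, b, c, d]))) = _
  simp only [hr]
  rw [Fin.sum_univ_four, Fin.sum_univ_three, i0, i1, i2, Finset.sum_insert (by decide),
    Finset.sum_pair (by decide), Finset.sum_pair (by decide), Finset.sum_singleton]
  change _ - ((-1 : ℤ) ^ 0 • θ (Matrix.vecCons (D.bracket a b) ((0 : Fin 3).removeNth ![b, c, d])) +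
    ((-1 : ℤ) ^ 1 • θ (Matrix.vecCons (D.bracket a c) ((1 : Fin 3).removeNth ![b, c, d])) +
    (-1 : ℤ) ^ 2 • θ (Matrix.vecCons (D.bracket a d) ((2 : Fin 3).removeNth ![b, c, d]))) +
    ((-1 : ℤ) ^ 2 • θ (Matrix.vecCons (D.bracket b c) ((1 : Fin 3).removeNth ![a, c, d])) +
    (-1 : ℤ) ^ 3 • θ (Matrix.vecCons (D.bracket b d) ((2 : Fin 3).removeNth ![a, c, d]))) +
    (-1 : ℤ) ^ 4 • θ (Matrix.vecCons (D.bracket c d) ((2 : Fin 3).removeNth ![a, b, d]))) = _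
  simp only [hr']
  simp
  abel

end DiracStructure

/-! ### The splitting of the Courant algebroid -/

namespace IsotropicComplement

variable [T2Space M] (S : IsotropicComplement D)

/-- The projection `Γ^∞(E) → Γ^∞(L')` along `L`. -/
def projCompl : Sections n F E →ₗ[SmoothFun n M] S.Sec :=
  S.ofDual ∘ₗ LinearMap.lcomp (SmoothFun n M) (SmoothFun n M) (sectionsOf n F D.L).subtype ∘ₗ
    C.pairLM

theorem pair_projCompl (e : Sections n F E) (s : D.Sec) :
    C.pair (S.projCompl e : Sections n F E) s = C.pair e s :=
  S.pair_ofDual _ s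

/-- A section that is orthogonal to `L` lies in `L`, because its component in `L'` is orthogonal to
both `L` and `L'`. -/
theorem sub_projCompl_mem (e : Sections n F E) :
    e - S.projCompl e ∈ sectionsOf n F D.L := by
  intro x
  obtain ⟨r, t, ht⟩ := D.subbundle.exists_frame x
  obtain ⟨u, hu, v, hv, huv⟩ := Submodule.mem_sup.1
    ((S.isCompl x).sup_eq_top ▸ (Submodule.mem_top :
      (e - S.projCompl e : Sections n F E) x ∈ ⊤))
  have hv0 : v = 0 := by
    apply S.form_zero_right hv
    intro w hw
    rw [← ht.self_of_nhds.2] at hw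
    induction hw using Submodule.span_induction with
    | mem w hw =>
      obtain ⟨i, rfl⟩ := hw
      have h1 : C.pair (e - S.projCompl e) (t i) = 0 := by
        rw [C.pair_sub_left, S.pair_projCompl, sub_self]
      have h2 : C.form x ((e - S.projCompl e : Sections n F E) x)
          ((t i : Sections n F E) x) = 0 :=
        congrArg (fun f : SmoothFun n M => f x) h1
      rw [← huv, map_add, LinearMap.add_apply, D.isotropic x u hu _ ((t i).2 x), zero_add] at h2
      rw [C.form_symm, h2]
    | zero => simp
    | add a b _ _ ha hb => rw [map_add, LinearMap.add_apply, ha, hb, add_zero]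
    | smul c a _ ha => rw [map_smul, LinearMap.smul_apply, ha, smul_zero]
  rw [← huv, hv0, add_zero]
  exact hu

/-- The projection `Γ^∞(E) → Γ^∞(L)` along `L'`. -/
def projDirac : Sections n F E →ₗ[ℝ] D.Sec :=
  ((LinearMap.id - (sectionsOf n F S.L').subtype ∘ₗ S.projCompl).codRestrict
    (sectionsOf n F D.L) S.sub_projCompl_mem).restrictScalars ℝ

theorem coe_projDirac (e : Sections n F E) :
    (S.projDirac e : Sections n F E) = e - S.projCompl e := rfl

theorem projDirac_coe (s : D.Sec) : S.projDirac (s : Sections n F E) = s := by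
  have : S.projCompl (s : Sections n F E) = 0 := S.rep_unique fun t => by
    rw [S.pair_projCompl, D.pair_eq_zero]
    simp only [Submodule.coe_zero, ← C.pairLM_apply, map_zero, LinearMap.zero_apply]
  apply Subtype.ext
  rw [coe_projDirac, this, Submodule.coe_zero, sub_zero]

/-- The map `η ↦ η(a) ∈ Γ^∞(L')` on two-forms. -/
def sharpLM (a : D.Sec) : D.Form 2 →ₗ[ℝ] S.Sec where
  toFun η := S.sharp η a
  map_add' η η' := S.rep_unique fun t => by
    rw [Submodule.coe_add, C.pair_add_left]
    simp only [pair_sharp]; rfl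
  map_smul' r η := S.rep_unique fun t => by
    simp only [RingHom.id_apply]
    rw [Submodule.coe_smul_of_tower, C.pair_real_smul_left]
    simp only [pair_sharp]; rfl

theorem sharp_add (η η' : D.Form 2) (a : D.Sec) :
    S.sharp (η + η') a = S.sharp η a + S.sharp η' a := (S.sharpLM a).map_add η η'

theorem sharp_smul (r : ℝ) (η : D.Form 2) (a : D.Sec) :
    S.sharp (r • η) a = r • S.sharp η a := (S.sharpLM a).map_smul r η

theorem sharp_zero (a : D.Sec) : S.sharp (0 : D.Form 2) a = 0 := (S.sharpLM a).map_zero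

/-! ### The graph of a two-form and its Bianchi identity -/

/-- The section `a + η(a)` of the graph of `η : L → L^* ≅ L'`. -/
def graphSection (η : D.Form 2) (a : D.Sec) : Sections n F E :=
  (a : Sections n F E) + S.sharp η a

theorem pair_graphSection (η : D.Form 2) (a b : D.Sec) :
    C.pair (S.graphSection η a) (S.graphSection η b) = 0 := by
  simp only [graphSection, C.pair_add_left, C.pair_add_right]
  rw [D.pair_eq_zero, S.pair_eq_zero, C.pair_comm (a : Sections n F E), pair_sharp, pair_sharp,
    DiracStructure.form_two_swap]
  ring

/-- The bracket `(a, b) ↦ pr_L [a + η(a), b + η(b)]` on `Γ^∞(L)`. If the graph of `η` is closed under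
the Courant bracket, it is the bracket of the graph, transported to `L`. -/
def graphBracket (η : D.Form 2) (a b : D.Sec) : D.Sec :=
  S.projDirac (C.bracket (S.graphSection η a) (S.graphSection η b))

/-- The Chevalley-Eilenberg formula for a three-form `θ`, with the anchor `a ↦ ρ(a + η(a))` and
the bracket `graphBracket`, evaluated at `a, b, c, d`. -/
def graphDifferential (η : D.Form 2) (θ : D.Form 3) (a b c d : D.Sec) : SmoothFun n M :=
  C.act (S.graphSection η a) (θ ![b, c, d]) - C.act (S.graphSection η b) (θ ![a, c, d]) +
    C.act (S.graphSection η c) (θ ![a, b, d]) - C.act (S.graphSection η d) (θ ![a, b, c]) -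
    θ ![S.graphBracket η a b, c, d] + θ ![S.graphBracket η a c, b, d] -
    θ ![S.graphBracket η a d, b, c] - θ ![S.graphBracket η b c, a, d] +
    θ ![S.graphBracket η b d, a, c] - θ ![S.graphBracket η c d, a, b]

/-- The Bianchi identity for the curvature `θ(a, b, c) = ⟨[a + η(a), b + η(b)], c + η(c)⟩` of the
graph of `η`. It is the Jacobi identity of the Courant bracket for `a + η(a)`, `b + η(b)`,
`c + η(c)`, paired with `d + η(d)`. -/
theorem graphDifferential_curvature (η : D.Form 2) (θ : D.Form 3)
    (hθ : ∀ a b c, θ ![a, b, c] =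
      C.pair (C.bracket (S.graphSection η a) (S.graphSection η b)) (S.graphSection η c))
    (a b c d : D.Sec) : S.graphDifferential η θ a b c d = 0 := by
  set e := S.graphSection η with he
  set u := S.graphBracket η with hu
  -- The component of `[e a, e b]` in `L'` along the graph of `η`.
  obtain ⟨τ, hτ⟩ : ∃ τ : D.Sec → D.Sec → S.Sec, ∀ a b,
      C.bracket (e a) (e b) = e (u a b) + τ a b :=
    ⟨fun a b => S.projCompl (C.bracket (e a) (e b)) - S.sharp η (u a b), fun a b => by
      have h : e (u a b) = (u a b : Sections n F E) + S.sharp η (u a b) := rfl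
      have h' : (u a b : Sections n F E) =
        C.bracket (e a) (e b) - S.projCompl (C.bracket (e a) (e b)) := rfl
      rw [h, AddSubgroupClass.coe_sub, h']
      abel⟩
  -- The graph and `L'` are isotropic, so only mixed pairings survive.
  have hpair : ∀ a b c, C.pair (τ a b : Sections n F E) (e c) = θ ![a, b, c] := fun a b c => by
    rw [hθ, hτ, C.pair_add_left, he, S.pair_graphSection, zero_add]
  have hpair' : ∀ a b c d, C.pair (τ a b : Sections n F E) (C.bracket (e c) (e d)) =
      θ ![a, b, u c d] := fun a b c d => by
    rw [hτ c d, C.pair_add_right, hpair, S.pair_eq_zero, add_zero]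
  -- The invariance of the pairing moves `τ` out of the outer bracket of the iterated brackets.
  have hR : ∀ a b c d, C.pair (C.bracket (e a) (C.bracket (e b) (e c))) (e d) =
      θ ![a, u b c, d] + C.act (e a) (θ ![b, c, d]) - θ ![b, c, u a d] := fun a b c d => by
    have h := C.act_pair (e a) (τ b c) (e d)
    rw [hpair, hpair'] at h
    rw [hτ b c, map_add, C.pair_add_left, ← hθ]
    linear_combination -h
  have hL : ∀ a b c d, C.pair (C.bracket (C.bracket (e a) (e b)) (e c)) (e d) =
      θ ![u a b, c, d] + C.act (e d) (θ ![a, b, c]) - C.act (e c) (θ ![a, b, d]) +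
        θ ![a, b, u c d] := fun a b c d => by
    have h := C.act_pair (e c) (τ a b) (e d)
    rw [hpair, hpair'] at h
    rw [hτ a b, map_add, LinearMap.add_apply, C.pair_add_left, ← hθ,
      C.pair_bracket_swap (τ a b : Sections n F E), hpair]
    linear_combination h
  have hJ := congrArg (fun s => C.pair s (e d)) (C.jacobi (e a) (e b) (e c))
  simp only [C.pair_add_left, hR, hL] at hJ
  have hcyc : ∀ x y z, θ ![x, y, z] = θ ![z, x, y] := fun x y z => by
    rw [DiracStructure.form_three_swap' θ x y z, DiracStructure.form_three_swap θ x z y, neg_neg]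
  rw [hcyc b c (u a d), hcyc a c (u b d), hcyc a b (u c d), DiracStructure.form_three_swap θ a,
    DiracStructure.form_three_swap θ b (u a c)] at hJ
  rw [graphDifferential]
  linear_combination hJ

/-! ### Dependence of the graph differential on its arguments -/

theorem graphDifferential_smul (η : D.Form 2) (r : ℝ) (θ : D.Form 3) (a b c d : D.Sec) :
    S.graphDifferential η (r • θ) a b c d = r • S.graphDifferential η θ a b c d := by
  simp only [graphDifferential, AlternatingMap.smul_apply, C.act_real_smul_right, smul_add,
    smul_sub]

theorem graphSection_zero (a : D.Sec) : S.graphSection 0 a = a := by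
  rw [graphSection, sharp_zero, Submodule.coe_zero, add_zero]

theorem graphBracket_zero (a b : D.Sec) : S.graphBracket 0 a b = D.bracket a b := by
  rw [graphBracket, graphSection_zero, graphSection_zero, ← D.coe_bracket, projDirac_coe]

theorem isPolynomialCurve_graphSection {η : ℝ → D.Form 2} (hη : IsPolynomialCurve η)
    (a : D.Sec) : IsPolynomialCurve fun t => S.graphSection (η t) a :=
  (IsPolynomialCurve.const (a : Sections n F E)).add
    (hη.map (((sectionsOf n F S.L').subtype.restrictScalars ℝ) ∘ₗ S.sharpLM a))

theorem isPolynomialCurve_graphBracket {η : ℝ → D.Form 2} (hη : IsPolynomialCurve η)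
    (a b : D.Sec) : IsPolynomialCurve fun t => S.graphBracket (η t) a b :=
  ((S.isPolynomialCurve_graphSection hη a).map₂ C.bracket
    (S.isPolynomialCurve_graphSection hη b)).map S.projDirac

/-- If `η` and `θ` depend polynomially on a parameter, then so does `graphDifferential η θ`, because
the anchor action, the Courant bracket and the evaluation of forms are real multilinear. -/
theorem isPolynomialCurve_graphDifferential {η : ℝ → D.Form 2} (hη : IsPolynomialCurve η)
    {θ : ℝ → D.Form 3} (hθ : IsPolynomialCurve θ) (a b c d : D.Sec) :
    IsPolynomialCurve fun t => S.graphDifferential (η t) (θ t) a b c d := by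
  have hact : ∀ x y z z', IsPolynomialCurve fun t =>
      C.act (S.graphSection (η t) x) (θ t ![y, z, z']) := fun x y z z' =>
    (S.isPolynomialCurve_graphSection hη x).map₂ C.actLM
      (hθ.map ({
      toFun := fun θ => θ ![y, z, z']
      map_add' := fun _ _ => rfl
      map_smul' := fun _ _ => rfl } : D.Form 3 →ₗ[ℝ] SmoothFun n M))
  have hbr : ∀ x y z z', IsPolynomialCurve fun t =>
      θ t ![S.graphBracket (η t) x y, z, z'] := fun x y z z' =>
    hθ.map₂ (LinearMap.mk₂ ℝ (fun (θ : D.Form 3) (s : D.Sec) => θ ![s, z, z'])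
      (fun _ _ _ => rfl) (fun _ _ _ => rfl)
      (fun θ s s' => θ.toMultilinearMap.cons_add ![z, z'] s s')
      (fun r θ s => by
        rw [← algebraMap_smul (SmoothFun n M) r s, Algebra.smul_def]
        exact θ.toMultilinearMap.cons_smul ![z, z'] _ s))
      (S.isPolynomialCurve_graphBracket hη x y)
  exact (((((((((hact a b c d).sub (hact b a c d)).add (hact c a b d)).sub (hact d a b c)).sub
    (hbr a b c d)).add (hbr a c b d)).sub (hbr a d b c)).sub (hbr b c a d)).add
    (hbr b d a c)).sub (hbr c d a b)

/-! ### Multilinearity of the brackets of forms -/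

theorem schouten_smul_left (r : ℝ) (η μ : D.Form 2) :
    S.schouten (r • η) μ = r • S.schouten η μ := by
  apply DiracStructure.form_three_ext
  intro a b c
  rw [AlternatingMap.smul_apply, schouten_apply, schouten_apply]
  simp only [schoutenTerm, pair_dualBracket, sharp_smul, AlternatingMap.smul_apply,
    Submodule.coe_smul_of_tower, map_smul, LinearMap.smul_apply, C.pair_real_smul_left,
    C.act_real_smul_left, C.act_real_smul_right, smul_add, smul_sub]

/-- The bracket `[·,·]_*` of two-forms as a real bilinear map. -/
def schoutenLM : D.Form 2 →ₗ[ℝ] D.Form 2 →ₗ[ℝ] D.Form 3 :=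
  LinearMap.mk₂ ℝ S.schouten S.schouten_add_left S.schouten_smul_left
    (fun η μ μ' => by
      rw [S.schouten_comm, S.schouten_add_left, S.schouten_comm μ, S.schouten_comm μ'])
    (fun r η μ => by rw [S.schouten_comm, S.schouten_smul_left, S.schouten_comm μ])

theorem schoutenLM_apply (η μ : D.Form 2) : S.schoutenLM η μ = S.schouten η μ := rfl

theorem ternary_apply (η μ ν : D.Form 2) (v : Fin 3 → D.Sec) :
    S.ternary η μ ν v = ∑ σ : Equiv.Perm (Fin 3), Equiv.Perm.sign σ •
      C.pair (C.bracket (S.sharp η (v (σ 0)) : Sections n F E) (S.sharp μ (v (σ 1))))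
        (S.sharp ν (v (σ 2))) := by
  rw [ternary, AlternatingMap.neg_apply, MultilinearMap.alternatization_apply,
    ← Finset.sum_neg_distrib]
  refine Finset.sum_congr rfl fun σ _ => ?_
  rw [← smul_neg]
  -- The sign of `ternary` cancels against that of `psi`.
  congr 1
  exact neg_neg _

/-- The ternary bracket `[·,·,·]_ψ` of two-forms as a real trilinear map. -/
def ternaryLM : D.Form 2 →ₗ[ℝ] D.Form 2 →ₗ[ℝ] D.Form 2 →ₗ[ℝ] D.Form 3 where
  toFun η := LinearMap.mk₂ ℝ (S.ternary η)
    (fun μ μ' ν => by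
      ext1 v
      simp only [AlternatingMap.add_apply, ternary_apply, sharp_add, Submodule.coe_add, map_add,
        C.pair_add_left, smul_add, Finset.sum_add_distrib])
    (fun r μ ν => by
      ext1 v
      simp only [AlternatingMap.smul_apply, ternary_apply, sharp_smul,
        Submodule.coe_smul_of_tower, map_smul, C.pair_real_smul_left, smul_comm _ r,
        Finset.smul_sum])
    (fun μ ν ν' => by
      ext1 v
      simp only [AlternatingMap.add_apply, ternary_apply, sharp_add, Submodule.coe_add,
        C.pair_add_right, smul_add, Finset.sum_add_distrib])
    (fun r μ ν => by
      ext1 v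
      simp only [AlternatingMap.smul_apply, ternary_apply, sharp_smul,
        Submodule.coe_smul_of_tower, C.pair_real_smul_right, smul_comm _ r, Finset.smul_sum])
  map_add' η η' := by
    refine LinearMap.ext fun μ => LinearMap.ext fun ν => AlternatingMap.ext fun v => ?_
    change S.ternary (η + η') μ ν v = S.ternary η μ ν v + S.ternary η' μ ν v
    simp only [ternary_apply, sharp_add, Submodule.coe_add, map_add, LinearMap.add_apply,
      C.pair_add_left, smul_add, Finset.sum_add_distrib]
  map_smul' r η := by
    refine LinearMap.ext fun μ => LinearMap.ext fun ν => AlternatingMap.ext fun v => ?_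
    change S.ternary (r • η) μ ν v = r • S.ternary η μ ν v
    simp only [ternary_apply, sharp_smul, Submodule.coe_smul_of_tower, map_smul,
      LinearMap.smul_apply, C.pair_real_smul_left, smul_comm _ r, Finset.smul_sum]

theorem ternaryLM_apply (η μ ν : D.Form 2) : S.ternaryLM η μ ν = S.ternary η μ ν := rfl

theorem schouten_zero_left (μ : D.Form 2) : S.schouten 0 μ = 0 := by
  simp [← schoutenLM_apply]

theorem schouten_zero_right (η : D.Form 2) : S.schouten η 0 = 0 := by
  simp [← schoutenLM_apply]

theorem ternary_zero_left (μ ν : D.Form 2) : S.ternary 0 μ ν = 0 := by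
  simp [← ternaryLM_apply]

theorem ternary_zero_middle (η ν : D.Form 2) : S.ternary η 0 ν = 0 := by
  simp [← ternaryLM_apply]

theorem ternary_zero_right (η μ : D.Form 2) : S.ternary η μ 0 = 0 := by
  simp [← ternaryLM_apply]

theorem obstruction_congr {N : ℕ} {w w' : ℕ → D.Form 2} (h : ∀ i ≤ N, w i = w' i) :
    S.obstruction N w = S.obstruction N w' := by
  rw [obstruction, obstruction]
  congr 2
  · congr 1
    refine Finset.sum_congr rfl fun i hi => ?_
    rw [Finset.mem_Icc] at hi
    rw [h i (by omega), h (N + 1 - i) (by omega)]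
  · refine Finset.sum_congr rfl fun i hi => Finset.sum_congr rfl fun j hj =>
      Finset.sum_congr rfl fun k hk => ?_
    rw [h i (Finset.mem_Icc.1 hi).2, h j (Finset.mem_Icc.1 hj).2, h k (Finset.mem_Icc.1 hk).2]

variable [ContMDiffVectorBundle ∞ F E (𝓡 n)]

theorem graphDifferential_zero (θ : D.Form 3) (a b c d : D.Sec) :
    S.graphDifferential 0 θ a b c d = D.dL 2 θ ![a, b, c, d] := by
  simp only [graphDifferential, graphSection_zero, graphBracket_zero, D.dL_three_apply,
    D.act_apply]

/-! ### The coefficients of the deformation equation -/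

/-- If `w` is finitely supported, then for every real `t` the left hand side of the deformation
equation for `η = ∑ t^i w_i` is the polynomial in `t` with the coefficients
`deformationCoeff w m`. -/
theorem deformation_sum (w : ℕ → D.Form 2) (K : ℕ) (hK : ∀ i, K ≤ i → w i = 0) (t : ℝ)
    (η : D.Form 2) (hη : η = ∑ i ∈ Finset.range K, t ^ i • w i) :
    D.dL 1 η + (1 / 2 : ℝ) • S.schouten η η + (1 / 6 : ℝ) • S.ternary η η η =
      ∑ m ∈ Finset.range (K + (K + K)), t ^ m • S.deformationCoeff w m := by
  have hsub : ∀ (g : ℕ → D.Form 3) (L : ℕ), L ≤ K + (K + K) → (∀ m, L ≤ m → g m = 0) →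
      ∑ m ∈ Finset.range L, t ^ m • g m = ∑ m ∈ Finset.range (K + (K + K)), t ^ m • g m := by
    intro g L hL hg
    refine Finset.sum_subset (Finset.range_subset_range.2 hL) fun m _ hm => ?_
    rw [hg m (by simpa using hm), smul_zero]
  have h1 : D.dL 1 η = ∑ m ∈ Finset.range (K + (K + K)), t ^ m • D.dL 1 (w m) := by
    rw [← hsub (fun m => D.dL 1 (w m)) K (by omega) fun m hm => by rw [hK m hm, map_zero], hη,
      map_sum]
    simp only [map_smul]
  have hz : ∀ φ : D.Form 2 →ₗ[ℝ] D.Form 2 →ₗ[ℝ] D.Form 3, ∀ m, K + K ≤ m →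
      ∑ p ∈ Finset.HasAntidiagonal.antidiagonal m, φ (w p.1) (w p.2) = 0 := by
    intro φ m hm
    refine Finset.sum_eq_zero fun p hp => ?_
    rw [Finset.HasAntidiagonal.mem_antidiagonal] at hp
    rcases (by omega : K ≤ p.1 ∨ K ≤ p.2) with h | h
    · rw [hK _ h, map_zero, LinearMap.zero_apply]
    · rw [hK _ h, map_zero]
  have h2 : S.schouten η η = ∑ m ∈ Finset.range (K + (K + K)), t ^ m •
      ∑ p ∈ Finset.HasAntidiagonal.antidiagonal m, S.schouten (w p.1) (w p.2) := by
    rw [← hsub (fun m => ∑ p ∈ Finset.HasAntidiagonal.antidiagonal m,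
      S.schouten (w p.1) (w p.2)) (K + K) (by omega) (hz S.schoutenLM), hη]
    exact bilinear_sum_pow_smul S.schoutenLM w w K K hK hK t
  have h3 : S.ternary η η η = ∑ m ∈ Finset.range (K + (K + K)), t ^ m •
      ∑ p ∈ Finset.HasAntidiagonal.antidiagonal m,
        ∑ q ∈ Finset.HasAntidiagonal.antidiagonal p.2, S.ternary (w p.1) (w q.1) (w q.2) := by
    have hi : ∀ i, S.ternary (w i) η η = ∑ m ∈ Finset.range (K + K), t ^ m •
        ∑ q ∈ Finset.HasAntidiagonal.antidiagonal m, S.ternary (w i) (w q.1) (w q.2) := fun i => by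
      rw [hη]
      exact bilinear_sum_pow_smul (S.ternaryLM (w i)) w w K K hK hK t
    rw [← sum_pow_smul_antidiagonal (fun i j => ∑ q ∈ Finset.HasAntidiagonal.antidiagonal j,
      S.ternary (w i) (w q.1) (w q.2)) K (K + K)
      (fun i j h => Finset.sum_eq_zero fun q _ => by rw [hK _ h, ternary_zero_left])
      (fun i j h => hz (S.ternaryLM (w i)) j h)]
    -- Only the first argument is expanded; `hi` then treats the other two.
    have hη' : S.ternary η η η = ∑ i ∈ Finset.range K, t ^ i • S.ternary (w i) η η := by
      have := congrArg (fun φ => φ η η) (congrArg S.ternaryLM hη)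
      simpa only [map_sum, LinearMap.sum_apply, map_smul, LinearMap.smul_apply,
        ternaryLM_apply] using this
    rw [hη']
    refine Finset.sum_congr rfl fun i _ => ?_
    rw [hi, Finset.smul_sum]
    simp only [pow_add, mul_smul]
  rw [h1, h2, h3, Finset.smul_sum, Finset.smul_sum, ← Finset.sum_add_distrib,
    ← Finset.sum_add_distrib]
  refine Finset.sum_congr rfl fun m _ => ?_
  rw [deformationCoeff, smul_add, smul_add, smul_comm (1 / 2 : ℝ), smul_comm (1 / 6 : ℝ)]

/-- The lowest coefficient of the deformation equation that need not vanish is `d_L`-closed: up to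
a power of `t` it is the value at `t = 0` of the curvature of the graph of `∑ t^i w_i`, to which the
Bianchi identity applies. -/
theorem dL_deformationCoeff (w : ℕ → D.Form 2) (K : ℕ) (hK : ∀ i, K ≤ i → w i = 0)
    (h0 : w 0 = 0) (m : ℕ) (hmK : m < K) (hm : ∀ l < m, S.deformationCoeff w l = 0) :
    D.dL 2 (S.deformationCoeff w m) = 0 := by
  -- `Q t` is the curvature divided by `t^m`.
  let γ : ℝ → D.Form 2 := fun t => ∑ i ∈ Finset.range K, t ^ i • w i
  let Q : ℝ → D.Form 3 := fun t =>
    ∑ l ∈ Finset.range (K + (K + K) - m), t ^ l • S.deformationCoeff w (m + l)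
  have hγ : IsPolynomialCurve γ := IsPolynomialCurve.sum _ fun i => .monomial i _
  have hQ : IsPolynomialCurve Q := IsPolynomialCurve.sum _ fun i => .monomial i _
  have hγ0 : γ 0 = 0 := Finset.sum_eq_zero fun i _ => by
    rcases Nat.eq_zero_or_pos i with rfl | hi
    · rw [h0, smul_zero]
    · rw [zero_pow hi.ne', zero_smul]
  have hQ0 : Q 0 = S.deformationCoeff w m := by
    refine (Finset.sum_eq_single 0 (fun l _ hl => ?_) fun h => ?_).trans ?_
    · rw [zero_pow hl, zero_smul]
    · exact absurd (Finset.mem_range.2 (by omega)) h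
    · rw [pow_zero, one_smul, add_zero]
  have hcurv : ∀ t, t ^ m • Q t =
      D.dL 1 (γ t) + (1 / 2 : ℝ) • S.schouten (γ t) (γ t) +
        (1 / 6 : ℝ) • S.ternary (γ t) (γ t) (γ t) := fun t => by
    rw [S.deformation_sum w K hK t (γ t) rfl]
    have hlow : ∑ l ∈ Finset.range m, t ^ l • S.deformationCoeff w l = 0 :=
      Finset.sum_eq_zero fun l hl => by rw [hm l (Finset.mem_range.1 hl), smul_zero]
    have hsplit := Finset.sum_range_add (fun l => t ^ l • S.deformationCoeff w l) m
      (K + (K + K) - m)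
    rw [Nat.add_sub_cancel' (by omega), hlow, zero_add] at hsplit
    rw [hsplit, Finset.smul_sum]
    simp only [pow_add, mul_smul]
  -- For `t ≠ 0` the power `t^m` cancels in the Bianchi identity, and `t = 0` follows by continuity.
  ext1 v
  have hv : v = ![v 0, v 1, v 2, v 3] := by funext i; fin_cases i <;> rfl
  rw [hv, ← hQ0, ← S.graphDifferential_zero, ← hγ0]
  refine (S.isPolynomialCurve_graphDifferential hγ hQ _ _ _ _).apply_zero_eq_zero fun t ht => ?_
  have h := S.graphDifferential_curvature (γ t) (t ^ m • Q t)
    (fun a b c => by rw [hcurv]; exact S.graph_apply (γ t) a b c) (v 0) (v 1) (v 2) (v 3)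
  rw [graphDifferential_smul] at h
  exact (smul_eq_zero.1 h).resolve_left (pow_ne_zero m ht)

/-! ### The obstruction class -/

theorem deformationCoeff_congr {m : ℕ} {w w' : ℕ → D.Form 2} (h : ∀ i ≤ m, w i = w' i) :
    S.deformationCoeff w m = S.deformationCoeff w' m := by
  rw [deformationCoeff, deformationCoeff, h m le_rfl]
  congr 2
  · congr 1
    refine Finset.sum_congr rfl fun p hp => ?_
    rw [Finset.HasAntidiagonal.mem_antidiagonal] at hp
    rw [h p.1 (by omega), h p.2 (by omega)]
  · refine Finset.sum_congr rfl fun p hp => Finset.sum_congr rfl fun q hq => ?_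
    rw [Finset.HasAntidiagonal.mem_antidiagonal] at hp hq
    rw [h p.1 (by omega), h q.1 (by omega), h q.2 (by omega)]

/-- As `w_0 = 0`, the coefficient of `t^{N+1}` in the deformation equation contains `w_{N+1}` only
through `d_L w_{N+1}`. -/
theorem deformationCoeff_succ (N : ℕ) {w : ℕ → D.Form 2} (h0 : w 0 = 0) :
    S.deformationCoeff w (N + 1) = D.dL 1 (w (N + 1)) - S.obstruction N w := by
  -- A sum over `i + j = N + 1` in which the extreme terms vanish.
  have hsum : ∀ f : ℕ → ℕ → D.Form 3, (∀ j, f 0 j = 0) → (∀ i, f i 0 = 0) →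
      ∑ p ∈ Finset.HasAntidiagonal.antidiagonal (N + 1), f p.1 p.2 =
        ∑ i ∈ Finset.Icc 1 N, f i (N + 1 - i) := by
    intro f hf hf'
    rw [Finset.Nat.sum_antidiagonal_eq_sum_range_succ f]
    symm
    refine Finset.sum_subset (fun i hi => ?_) fun i hi hi' => ?_
    · rw [Finset.mem_Icc] at hi
      rw [Finset.mem_range]
      omega
    · rw [Finset.mem_range] at hi
      rw [Finset.mem_Icc] at hi'
      rcases (by omega : i = 0 ∨ i = N + 1) with rfl | rfl
      · exact hf _
      · rw [Nat.sub_self]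
        exact hf' _
  have h2 : ∑ p ∈ Finset.HasAntidiagonal.antidiagonal (N + 1), S.schouten (w p.1) (w p.2) =
      ∑ i ∈ Finset.Icc 1 N, S.schouten (w i) (w (N + 1 - i)) :=
    hsum (fun i j => S.schouten (w i) (w j)) (fun j => by rw [h0, schouten_zero_left])
      fun i => by rw [h0, schouten_zero_right]
  have h3 : ∑ p ∈ Finset.HasAntidiagonal.antidiagonal (N + 1),
      ∑ q ∈ Finset.HasAntidiagonal.antidiagonal p.2, S.ternary (w p.1) (w q.1) (w q.2) =
      ∑ i ∈ Finset.Icc 1 N, ∑ j ∈ Finset.Icc 1 N, ∑ k ∈ Finset.Icc 1 N,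
        if i + j + k = N + 1 then S.ternary (w i) (w j) (w k) else 0 := by
    rw [hsum (fun i m => ∑ q ∈ Finset.HasAntidiagonal.antidiagonal m,
        S.ternary (w i) (w q.1) (w q.2))
      (fun j => Finset.sum_eq_zero fun q _ => by rw [h0, ternary_zero_left])
      (fun i => by simp [h0, ternary_zero_right])]
    refine Finset.sum_congr rfl fun i hi => ?_
    rw [Finset.mem_Icc] at hi
    -- For `1 ≤ i ≤ N` the pairs `j, k ≥ 1` with `j + k = N + 1 - i` automatically satisfy `j, k ≤ N`.
    rw [← Finset.sum_product', ← Finset.sum_filter]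
    symm
    refine Finset.sum_subset (fun q hq => ?_) fun q hq hq' => ?_
    · rw [Finset.mem_filter] at hq
      rw [Finset.HasAntidiagonal.mem_antidiagonal]
      omega
    · rw [Finset.HasAntidiagonal.mem_antidiagonal] at hq
      rw [Finset.mem_filter, Finset.mem_product, Finset.mem_Icc, Finset.mem_Icc] at hq'
      rcases (by omega : q.1 = 0 ∨ q.2 = 0) with h | h
      · rw [h, h0, ternary_zero_middle]
      · rw [h, h0, ternary_zero_right]
  rw [deformationCoeff, h2, h3, obstruction]
  abel

theorem dL_obstruction {N : ℕ} {w : ℕ → D.Form 2} (hw : S.IsFormalDeformation N w) :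
    D.dL 2 (S.obstruction N w) = 0 := by
  -- Truncation after `t^N` does not change the obstruction.
  let w' : ℕ → D.Form 2 := fun i => if i ≤ N then w i else 0
  have hw' : ∀ i ≤ N, w' i = w i := fun i hi => if_pos hi
  have h0 : w' 0 = 0 := (hw' 0 N.zero_le).trans hw.1
  -- The support of `w'` lies below `N + 1`; the bound `N + 2` also exceeds the degree `N + 1`.
  have h := S.dL_deformationCoeff w' (N + 2) (fun i hi => if_neg (by omega)) h0 (N + 1)
    (by omega) fun l hl => by
      rw [S.deformationCoeff_congr fun i hi => hw' i (by omega)]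
      exact hw.2 l (by omega)
  have hN : w' (N + 1) = 0 := if_neg (by omega)
  rwa [S.deformationCoeff_succ N h0, hN, map_zero, zero_sub, map_neg, neg_eq_zero,
    S.obstruction_congr hw'] at h

theorem extends_iff {N : ℕ} {w : ℕ → D.Form 2} (hw : S.IsFormalDeformation N w) :
    S.Extends N w ↔ ∃ η : D.Form 2, D.dL 1 η = S.obstruction N w := by
  constructor
  · rintro ⟨w', hw', h0, h⟩
    refine ⟨w' (N + 1), ?_⟩
    rw [← S.obstruction_congr hw', ← sub_eq_zero, ← S.deformationCoeff_succ N h0]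
    exact h (N + 1) le_rfl
  · rintro ⟨η, hη⟩
    have hw' : ∀ i ≤ N, Function.update w (N + 1) η i = w i := fun i hi =>
      Function.update_of_ne (by omega) _ _
    have h0 : Function.update w (N + 1) η 0 = 0 := (hw' 0 N.zero_le).trans hw.1
    refine ⟨Function.update w (N + 1) η, hw', h0, fun m hm => ?_⟩
    rcases Nat.le_succ_iff.1 hm with hm | rfl
    · rw [S.deformationCoeff_congr fun i hi => hw' i (hi.trans hm)]
      exact hw.2 m hm
    · rw [S.deformationCoeff_succ N h0, Function.update_self, S.obstruction_congr hw', hη,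
        sub_self]

end IsotropicComplement

theorem DiracStructure.cohomologyClass_eq_zero_iff [T2Space M]
    [ContMDiffVectorBundle ∞ F E (𝓡 n)]
    (D : DiracStructure C) {k : ℕ} (θ : D.Form (k + 2)) (h : D.dL (k + 1) θ = 0) :
    D.cohomologyClass θ h = 0 ↔ ∃ η : D.Form (k + 1), D.dL k η = θ := by
  rw [cohomologyClass, Submodule.Quotient.mk_eq_zero]
  rfl

end Graph

end

end CourantDeformation

theorem mainTheorem1 {n : ℕ} {M : Type*} [TopologicalSpace M] [T2Space M]
    [ChartedSpace (EuclideanSpace ℝ (Fin n)) M] [IsManifold (𝓡 n) ∞ M]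
    {F : Type*} [NormedAddCommGroup F] [NormedSpace ℝ F] [FiniteDimensional ℝ F]
    {E : M → Type*} [∀ x, AddCommGroup (E x)] [∀ x, Module ℝ (E x)]
    [∀ x, TopologicalSpace (E x)] [TopologicalSpace (Bundle.TotalSpace F E)]
    [FiberBundle F E] [VectorBundle ℝ F E] [ContMDiffVectorBundle ∞ F E (𝓡 n)]
    (C : CourantDeformation.CourantAlgebroid n F E)
    (D : CourantDeformation.DiracStructure C)
    (S : CourantDeformation.IsotropicComplement D)
    (N : ℕ) (w : ℕ → D.Form 2) (hw : S.IsFormalDeformation N w) :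
    ∃ hR : D.dL 2 (S.obstruction N w) = 0,
      (S.Extends N w ↔ ∃ η : D.Form 2, D.dL 1 η = S.obstruction N w) ∧
      (S.Extends N w ↔ D.cohomologyClass (k := 1) (S.obstruction N w) hR = 0) :=
  ⟨S.dL_obstruction hw, S.extends_iff hw,
    (S.extends_iff hw).trans (D.cohomologyClass_eq_zero_iff _ _).symm⟩
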